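/- Let $H\in(1/2,1)$ and $\theta>0$. Let $B^H$ be a fractional Brownian motion with Hurst index $H$ (a centred Gaussian process on $[0,\infty)$ with covariance $\tfrac12(t^{2H}+s^{2H}-|t-s|^{2H})$ and a.s. continuous paths), and let $U_H(t)=e^{-t/\theta}\int_0^t e^{s/\theta}\,dB^H(s)$, $t\ge0$, be the fractional Ornstein–Uhlenbeck process, the integral being a pathwise Riemann–Stieltjes integral. Let $\sigma$ be a driftless subordinator with Lévy measure $\nu$ on $(0,\infty)$, where $\int_0^\infty(1\wedge x)\,\nu(dx)<\infty$ and $\nu(0,\infty)=\infty$, so that $\mathbb E[e^{-\lambda\sigma(y)}]=e^{-y\Psi(\lambda)}$ with $\Psi(\lambda)=\int_0^\infty(1-e^{-\lambda x})\,\nu(dx)$. Let $E(t)=\inf\{y>0:\sigma(y)>t\}$ be its inverse, assume that the processes $U_H$ and $E$ are independent, and put $U_H^\Psi(t)=U_H(E(t))$. Write $V_{m,H}(t)=\mathbb E|U_H(t)|^m$ and $V^\Psi_{m,H}(t)=\mathbb E|U^\Psi_H(t)|^m$, and for $n\in\mathbb N$ put $$V_{2n,H}(\infty)=\frac{2^n\,\Gamma\!\left(\frac{2n+1}{2}\right)}{\sqrt\pi}\bigl(\theta^{2H}H\,\Gamma(2H)\bigr)^n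 .$$ For every $n\in\mathbb N$, the moments $V_{2n,H}(y)$ and $V^\Psi_{2n,H}(t)$ are finite, $V_{2n,H}(\infty)=\lim_{y\to\infty}V_{2n,H}(y)$, and the following hold. 1) If, for every $t>0$, $f_E(t,\cdot)$ is a probability density of $E(t)$ on $(0,\infty)$, then for every $t>0$ $$V^\Psi_{2n,H}(t)=\int_0^\infty V_{2n,H}(y)\,f_E(t,y)\,dy .$$ Moreover $V^\Psi_{2n,H}(t)\le V_{2n,H}(\infty)$ for all $t\ge0$; consequently, for every $m\in\mathbb N$, the absolute moment $V^\Psi_{m,H}(t)$ is finite and bounded in $t\ge0$. If, in addition, $t\mapsto f_E(t,y)$ is continuous on $(0,\infty)$ for every $y>0$, then $V^\Psi_{2n,H}$ is continuous on $[0,\infty)$. 2) $V^\Psi_{2n,H}$ is nondecreasing on $[0,\infty)$. 3) $\lim_{t\to\infty}V^\Psi_{2n,H}(t)=V_{2n,H}(\infty)$, and $$V_{2n,H}(\infty)=\frac{2^n\,\Gamma\!\left(\frac{2n+1}{2}\right)}{\sqrt\pi}\,H^n(2H-1)^n\,\Gamma(2nH+1)\,\theta^{2nH}\int_{[0,\infty)^{2n}}\frac{\prod_{i=1}^n|x_i-y_i|^{2H-2}}{\bigl(1+\sum_{i=1}^n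 x_i+\sum_{i=1}^n y_i\bigr)^{2nH+1}}\,\prod_{i=1}^n dx_i\,dy_i ,$$ where the multiple integral converges. -/

import Mathlib

open MeasureTheory ProbabilityTheory Filter Topology Set
open scoped NNReal ENNReal

noncomputable section

namespace TimeChangedFOU

variable {Ω : Type*} [MeasurableSpace Ω]

/-- `I` is the Riemann–Stieltjes integral of `f` with respect to the path `g` over `[0, t]`: the
limit of the sums `∑ f(ξ_k) (g(p_{k+1}) - g(p_k))` over tagged partitions
`0 = p_0 ≤ ξ_0 ≤ p_1 ≤ … ≤ p_m = t` as the mesh tends to `0`. -/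
def IsRiemannStieltjesIntegral (f g : ℝ≥0 → ℝ) (t : ℝ≥0) (I : ℝ) : Prop :=
  ∀ ε : ℝ, 0 < ε → ∃ δ : ℝ, 0 < δ ∧
    ∀ (m : ℕ) (p ξ : ℕ → ℝ≥0), p 0 = 0 → p m = t →
      (∀ k < m, p k ≤ ξ k ∧ ξ k ≤ p (k + 1) ∧ (p (k + 1) : ℝ) - p k < δ) →
      |(∑ k ∈ Finset.range m, f (ξ k) * (g (p (k + 1)) - g (p k))) - I| < ε

open Classical in
/-- The Riemann–Stieltjes integral `∫₀ᵗ f dg` (and `0` if it does not exist). -/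
def riemannStieltjes (f g : ℝ≥0 → ℝ) (t : ℝ≥0) : ℝ :=
  if h : ∃ I, IsRiemannStieltjesIntegral f g t I then h.choose else 0

/-- Fractional Brownian motion with Hurst index `H`: a centred Gaussian process with covariance
`(t^{2H} + s^{2H} - |t - s|^{2H}) / 2` and almost surely continuous paths. -/
structure IsFractionalBrownianMotion (P : Measure Ω) (H : ℝ) (B : ℝ≥0 → Ω → ℝ) : Prop where
  gaussian : IsGaussianProcess B P
  mean_zero : ∀ t, ∫ ω, B t ω ∂P = 0
  covariance : ∀ s t : ℝ≥0, ∫ ω, B t ω * B s ω ∂P =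
    1 / 2 * ((t : ℝ) ^ (2 * H) + (s : ℝ) ^ (2 * H) - |(t : ℝ) - s| ^ (2 * H))
  continuous_paths : ∀ᵐ ω ∂P, Continuous fun t => B t ω

/-- The fractional Ornstein–Uhlenbeck process started at zero,
`U(t) = e^{-t/θ} ∫₀ᵗ e^{s/θ} dB(s)`. -/
def fOU (θ : ℝ) (B : ℝ≥0 → Ω → ℝ) (t : ℝ≥0) (ω : Ω) : ℝ :=
  Real.exp (-(t : ℝ) / θ) *
    riemannStieltjes (fun s => Real.exp ((s : ℝ) / θ)) (fun s => B s ω) t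

/-- `ν` is the Lévy measure of a subordinator: it is carried by `(0, ∞)` and
`∫ (1 ∧ x) ν(dx) < ∞`. -/
structure IsSubordinatorLevyMeasure (ν : Measure ℝ) : Prop where
  support : ν (Iic 0) = 0
  integrable : ∫⁻ x in Ioi (0 : ℝ), ENNReal.ofReal (min 1 x) ∂ν < ∞

/-- The Laplace exponent `Ψ(λ) = ∫_{(0, ∞)} (1 - e^{-λ x}) ν(dx)`. -/
def laplaceExponent (ν : Measure ℝ) (l : ℝ) : ℝ :=
  ∫ x in Ioi (0 : ℝ), (1 - Real.exp (-l * x)) ∂ν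

/-- `σ` is a driftless subordinator with Lévy measure `ν`: a process started at `0` with
independent and stationary increments, almost surely nondecreasing right-continuous paths, and
`E[e^{-λ σ(y)}] = e^{-y Ψ(λ)}`. -/
structure IsDriftlessSubordinator (P : Measure Ω) (ν : Measure ℝ) (σ : ℝ≥0 → Ω → ℝ) : Prop where
  levy : IsSubordinatorLevyMeasure ν
  aemeasurable : ∀ y, AEMeasurable (σ y) P
  start : ∀ᵐ ω ∂P, σ 0 ω = 0
  indep_increments : HasIndepIncrements σ P
  stationary_increments : ∀ s h : ℝ≥0,
    IdentDistrib (fun ω => σ (s + h) ω - σ s ω) (σ h) P P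
  paths : ∀ᵐ ω ∂P, Monotone (fun y => σ y ω) ∧
    ∀ y, ContinuousWithinAt (fun z => σ z ω) (Ici y) y
  laplace : ∀ (y : ℝ≥0) (l : ℝ), 0 < l →
    ∫ ω, Real.exp (-l * σ y ω) ∂P = Real.exp (-(y : ℝ) * laplaceExponent ν l)

/-- The inverse subordinator `E(t) = inf {y > 0 : σ(y) > t}`. -/
def inverseSubordinator (σ : ℝ≥0 → Ω → ℝ) (t : ℝ≥0) (ω : Ω) : ℝ≥0 :=
  sInf {y : ℝ≥0 | 0 < y ∧ (t : ℝ) < σ y ω}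

/-- The time-changed process `t ↦ X(E(t))`. -/
def timeChange (X : ℝ≥0 → Ω → ℝ) (E : ℝ≥0 → Ω → ℝ≥0) (t : ℝ≥0) (ω : Ω) : ℝ :=
  X (E t ω) ω

/-- The absolute moment `E[|X(t)|^m]`. -/
def absMoment (P : Measure Ω) (X : ℝ≥0 → Ω → ℝ) (m : ℕ) (t : ℝ≥0) : ℝ :=
  ∫ ω, |X t ω| ^ m ∂P

/-- For every `t > 0`, the function `f t` is a probability density of `E(t)` on `(0, ∞)`. -/
def IsDensityFamily (P : Measure Ω) (E : ℝ≥0 → Ω → ℝ≥0) (f : ℝ≥0 → ℝ → ℝ) : Prop :=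
  ∀ t : ℝ≥0, 0 < t → Measurable (f t) ∧ (∀ y, 0 < y → 0 ≤ f t y) ∧
    P.map (fun ω => (E t ω : ℝ)) =
      (volume.restrict (Ioi 0)).withDensity fun y => ENNReal.ofReal (f t y)

/-- `V_{2,H}(∞) = θ^{2H} H Γ(2H)`. -/
def varianceAtInfinity (H θ : ℝ) : ℝ :=
  θ ^ (2 * H) * H * Real.Gamma (2 * H)

/-- `V_{2n,H}(∞) = 2^n Γ((2n+1)/2) / √π · V_{2,H}(∞)^n`. -/
def momentAtInfinity (H θ : ℝ) (n : ℕ) : ℝ :=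
  2 ^ n * Real.Gamma ((2 * (n : ℝ) + 1) / 2) / √Real.pi * varianceAtInfinity H θ ^ n

/-- The domain `[0, ∞)^{2n}`, as `n` pairs `(x_i, y_i)`. -/
def orthant (n : ℕ) : Set (Fin n → ℝ × ℝ) :=
  {z | ∀ i, 0 ≤ (z i).1 ∧ 0 ≤ (z i).2}

/-- `∏ |x_i - y_i|^{2H-2} / (1 + ∑ x_i + ∑ y_i)^{2nH+1}`. -/
def multipleIntegrand (H : ℝ) (n : ℕ) (z : Fin n → ℝ × ℝ) : ℝ :=
  (∏ i, |(z i).1 - (z i).2| ^ (2 * H - 2)) /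
    (1 + ∑ i, (z i).1 + ∑ i, (z i).2) ^ (2 * (n : ℝ) * H + 1)

end TimeChangedFOU

end

noncomputable section

namespace TimeChangedFOU

section

/-! ### Gamma integrals -/

/-! Everything reduces to one deterministic function, the variance of $U_H$. For $H>1/2$ the
covariance of $B^H$ is the double integral of $H(2H-1)|u-v|^{2H-2}$ over a rectangle, so the second
moments of Riemann sums of $e^{s/\theta}$ against $B^H$ are quadratic forms in this kernel.
Integration by parts shows that these sums converge along continuous paths. Passing to the limit and
reflecting $s\mapsto t-s$, $U_H(t)$ is centred Gaussian with variance
$H(2H-1)\iint_{(0,t]^2}|x-y|^{2H-2}e^{-(x+y)/\theta}\,dx\,dy$ (`map_fOU`). The integrand is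
nonnegative and does not depend on $t$, so the variance is nondecreasing, and a Gamma integral over
the quadrant gives its limit (`lintegral_expKernel`). Even moments are a constant times powers of
the variance; hence $V_{2n,H}$ is continuous, nondecreasing and bounded by its limit.

Conditioning on the independent clock gives $V^\Psi_{2n,H}(t)=\mathbb E[V_{2n,H}(E(t))]$
(`lintegral_timeChange`, `absMoment_timeChange`), which is the density formula after a change of
variables. Because $\nu$ is infinite, $\Psi(\lambda)\to\infty$, so $\sigma$ is almost surely
strictly increasing and unbounded (`ae_strictMono`, `ae_unbounded`). Its inverse is then continuous,
nondecreasing and tends to infinity, and monotonicity, continuity and the limit pass through the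
expectation by bounded convergence.

The multiple integral is evaluated by writing $\Gamma(A)S^{-A}=\int_0^\infty r^{A-1}e^{-Sr}\,dr$
with $A=2nH+1$: for fixed $r$ the integrand splits into $n$ independent pairs
(`lintegral_multipleIntegrand`). -/

theorem integrableOn_rpow_sub_one_mul_exp {s r : ℝ} (hs : 0 < s) (hr : 0 < r) :
    IntegrableOn (fun t : ℝ => t ^ (s - 1) * Real.exp (-(r * t))) (Ioi 0) := by
  -- A non-integrable function has Bochner integral `0`, so a nonzero value proves integrability.
  refine not_imp_comm.1 integral_undef ?_
  rw [Real.integral_rpow_mul_exp_neg_mul_Ioi hs hr]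
  have := Real.Gamma_pos_of_pos hs
  positivity

theorem lintegral_rpow_sub_one_mul_exp {s r : ℝ} (hs : 0 < s) (hr : 0 < r) :
    ∫⁻ t in Ioi (0 : ℝ), ENNReal.ofReal (t ^ (s - 1) * Real.exp (-(r * t))) =
      ENNReal.ofReal ((1 / r) ^ s * Real.Gamma s) := by
  rw [← Real.integral_rpow_mul_exp_neg_mul_Ioi hs hr,
    ofReal_integral_eq_lintegral_ofReal (integrableOn_rpow_sub_one_mul_exp hs hr)]
  exact (ae_restrict_mem measurableSet_Ioi).mono fun t ht =>
    mul_nonneg (Real.rpow_nonneg (le_of_lt ht) _) (Real.exp_pos _).le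

/-- The kernel `|x - y|^a e^{-r (x + y)}`. -/
def expKernel (a r : ℝ) (z : ℝ × ℝ) : ℝ :=
  |z.1 - z.2| ^ a * Real.exp (-(r * (z.1 + z.2)))

theorem expKernel_nonneg (a r : ℝ) (z : ℝ × ℝ) : 0 ≤ expKernel a r z :=
  mul_nonneg (Real.rpow_nonneg (abs_nonneg _) _) (Real.exp_pos _).le

@[fun_prop]
theorem measurable_expKernel (a r : ℝ) : Measurable (expKernel a r) := by
  unfold expKernel
  fun_prop

theorem expKernel_swap (a r x y : ℝ) : expKernel a r (x, y) = expKernel a r (y, x) := by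
  simp only [expKernel, abs_sub_comm x y, add_comm x y]

/-- The shift $y=x+z$ separates the kernel into $e^{-2rx}\cdot z^a e^{-rz}$, leaving a Gamma
integral in $z$. -/
theorem lintegral_expKernel_Ioi {a r : ℝ} (ha : -1 < a) (hr : 0 < r) (x : ℝ) :
    ∫⁻ y in Ioi x, ENNReal.ofReal (expKernel a r (x, y)) =
      ENNReal.ofReal (Real.exp (-(2 * r * x))) *
        ENNReal.ofReal ((1 / r) ^ (a + 1) * Real.Gamma (a + 1)) := by
  rw [← lintegral_rpow_sub_one_mul_exp (by linarith) hr,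
    ← lintegral_const_mul _ (by fun_prop), ← lintegral_indicator measurableSet_Ioi,
    ← lintegral_indicator measurableSet_Ioi,
    ← lintegral_add_left_eq_self _ x]
  refine lintegral_congr fun z => ?_
  by_cases hz : 0 < z
  · rw [indicator_of_mem (by simpa using hz), indicator_of_mem (by simpa using hz),
      ← ENNReal.ofReal_mul (Real.exp_pos _).le]
    congr 1
    simp only [expKernel]
    rw [show x - (x + z) = -z by ring, abs_neg, abs_of_pos hz, add_sub_cancel_right,
      mul_left_comm, ← Real.exp_add]
    congr 2
    ring
  · rw [indicator_of_notMem (by simpa using hz), indicator_of_notMem (by simpa using hz)]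

/-- By symmetry the quadrant contributes twice the half above the diagonal. The condition $a>-1$
makes the diagonal singularity integrable; for $a=2H-2$ it reads $H>1/2$. -/
theorem lintegral_expKernel {a r : ℝ} (ha : -1 < a) (hr : 0 < r) :
    ∫⁻ z in Ioi (0 : ℝ) ×ˢ Ioi (0 : ℝ), ENNReal.ofReal (expKernel a r z) =
      ENNReal.ofReal ((1 / r) ^ (a + 2) * Real.Gamma (a + 1)) := by
  have hm := measurable_expKernel a r
  have hG : 0 < Real.Gamma (a + 1) := Real.Gamma_pos_of_pos (by linarith)
  have hupper : ∫⁻ x in Ioi (0 : ℝ), ∫⁻ y in Ioi x, ENNReal.ofReal (expKernel a r (x, y)) =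
      ENNReal.ofReal ((1 / 2) * ((1 / r) ^ (a + 2) * Real.Gamma (a + 1))) := by
    simp_rw [lintegral_expKernel_Ioi ha hr]
    rw [lintegral_mul_const _ (by fun_prop)]
    have := lintegral_rpow_sub_one_mul_exp (s := 1) (r := 2 * r) one_pos (by positivity)
    simp only [sub_self, Real.rpow_zero, one_mul] at this
    have h2 : (1 / r) ^ (a + 2) = 1 / r * (1 / r) ^ (a + 1) := by
      rw [show a + 2 = 1 + (a + 1) by ring, Real.rpow_add (by positivity), Real.rpow_one]
    rw [this, ← ENNReal.ofReal_mul (by positivity), h2, Real.rpow_one, Real.Gamma_one]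
    congr 1
    generalize (1 / r) ^ (a + 1) = c
    field_simp
  -- Both sides are integrals over the triangle below the diagonal, in the two orders of
  -- integration, with the symmetry of the kernel used on the right.
  have hswap : ∫⁻ x in Ioi (0 : ℝ), ∫⁻ y in Ioo 0 x, ENNReal.ofReal (expKernel a r (x, y)) =
      ∫⁻ x in Ioi (0 : ℝ), ∫⁻ y in Ioi x, ENNReal.ofReal (expKernel a r (x, y)) := by
    have hS : MeasurableSet {p : ℝ × ℝ | 0 < p.2 ∧ p.2 < p.1} :=
      (measurableSet_lt measurable_const measurable_snd).inter
        (measurableSet_lt measurable_snd measurable_fst)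
    have h1 : ∫⁻ x in Ioi (0 : ℝ), ∫⁻ y in Ioo 0 x, ENNReal.ofReal (expKernel a r (x, y)) =
        ∫⁻ x, ∫⁻ y, {p : ℝ × ℝ | 0 < p.2 ∧ p.2 < p.1}.indicator
          (fun p => ENNReal.ofReal (expKernel a r p)) (x, y) := by
      rw [← lintegral_indicator measurableSet_Ioi]
      refine lintegral_congr fun x => ?_
      by_cases hx : 0 < x
      · rw [indicator_of_mem (by simpa using hx), ← lintegral_indicator measurableSet_Ioo]
        refine lintegral_congr fun y => ?_
        simp only [indicator, mem_Ioo, mem_ofPred_eq]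
      · rw [indicator_of_notMem (by simpa using hx)]
        symm
        rw [lintegral_eq_zero_of_ae_eq_zero]
        refine ae_of_all _ fun y => ?_
        exact indicator_of_notMem (fun h => hx (h.1.trans h.2)) _
    have h2 : ∫⁻ x in Ioi (0 : ℝ), ∫⁻ y in Ioi x, ENNReal.ofReal (expKernel a r (x, y)) =
        ∫⁻ y, ∫⁻ x, {p : ℝ × ℝ | 0 < p.2 ∧ p.2 < p.1}.indicator
          (fun p => ENNReal.ofReal (expKernel a r p)) (x, y) := by
      rw [← lintegral_indicator measurableSet_Ioi]
      refine lintegral_congr fun x => ?_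
      by_cases hx : 0 < x
      · rw [indicator_of_mem (by simpa using hx), ← lintegral_indicator measurableSet_Ioi]
        refine lintegral_congr fun y => ?_
        simp only [indicator, mem_Ioi, mem_ofPred_eq, hx, true_and, expKernel_swap a r x y]
      · rw [indicator_of_notMem (by simpa using hx)]
        symm
        rw [lintegral_eq_zero_of_ae_eq_zero]
        refine ae_of_all _ fun y => ?_
        exact indicator_of_notMem (fun h => hx h.1) _
    rw [h1, h2, lintegral_lintegral_swap]
    exact ((hm.ennreal_ofReal).indicator hS).aemeasurable
  have hsplit : ∀ x ∈ Ioi (0 : ℝ), ∫⁻ y in Ioi 0, ENNReal.ofReal (expKernel a r (x, y)) =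
      (∫⁻ y in Ioo 0 x, ENNReal.ofReal (expKernel a r (x, y))) +
        ∫⁻ y in Ioi x, ENNReal.ofReal (expKernel a r (x, y)) := by
    intro x hx
    rw [← Ioc_union_Ioi_eq_Ioi (le_of_lt hx : (0 : ℝ) ≤ x),
      lintegral_union measurableSet_Ioi (Ioc_disjoint_Ioi le_rfl),
      setLIntegral_congr Ioo_ae_eq_Ioc]
  have hmeas : Measurable fun x : ℝ =>
      ∫⁻ y in Ioi x, ENNReal.ofReal (expKernel a r (x, y)) := by
    simp_rw [lintegral_expKernel_Ioi ha hr]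
    fun_prop
  rw [Measure.volume_eq_prod, setLIntegral_prod _ hm.ennreal_ofReal.aemeasurable,
    setLIntegral_congr_fun measurableSet_Ioi hsplit, lintegral_add_right _ hmeas, hswap, hupper,
    ← ENNReal.ofReal_add (by positivity) (by positivity)]
  congr 1
  ring

theorem integrableOn_expKernel {a r : ℝ} (ha : -1 < a) (hr : 0 < r) :
    IntegrableOn (expKernel a r) (Ioi (0 : ℝ) ×ˢ Ioi (0 : ℝ)) := by
  refine (lintegral_ofReal_ne_top_iff_integrable (by fun_prop)
    (ae_of_all _ (expKernel_nonneg a r))).1 ?_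
  rw [lintegral_expKernel ha hr]
  exact ENNReal.ofReal_ne_top

theorem integral_expKernel {a r : ℝ} (ha : -1 < a) (hr : 0 < r) :
    ∫ z in Ioi (0 : ℝ) ×ˢ Ioi (0 : ℝ), expKernel a r z =
      (1 / r) ^ (a + 2) * Real.Gamma (a + 1) := by
  have hG : 0 < Real.Gamma (a + 1) := Real.Gamma_pos_of_pos (by linarith)
  rw [integral_eq_lintegral_of_nonneg_ae (ae_of_all _ (expKernel_nonneg a r)) (by fun_prop),
    lintegral_expKernel ha hr, ENNReal.toReal_ofReal (by positivity)]

/-! ### The multiple integral -/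

/-- The coordinate faces are null, so the closed orthant may be treated as a product of open
quadrants, over which product integrands factor. -/
theorem restrict_orthant (n : ℕ) :
    (volume : Measure (Fin n → ℝ × ℝ)).restrict (orthant n) =
      Measure.pi fun _ : Fin n =>
        (volume : Measure (ℝ × ℝ)).restrict (Ioi (0 : ℝ) ×ˢ Ioi (0 : ℝ)) := by
  have h : orthant n = Set.pi univ fun _ : Fin n => Ici (0 : ℝ) ×ˢ Ici (0 : ℝ) := by
    ext z
    simp only [orthant, Set.mem_pi, mem_ofPred_eq, mem_univ, forall_const, mem_prod, mem_Ici]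
  rw [h, volume_pi, Measure.restrict_pi_pi]
  congr 1
  funext i
  refine Measure.restrict_congr_set ?_
  rw [Measure.volume_eq_prod]
  exact Measure.set_prod_ae_eq Ioi_ae_eq_Ici.symm Ioi_ae_eq_Ici.symm

theorem measurableSet_orthant (n : ℕ) : MeasurableSet (orthant n) := by
  have h : orthant n = Set.pi univ fun _ : Fin n => Ici (0 : ℝ) ×ˢ Ici (0 : ℝ) := by
    ext z
    simp only [orthant, Set.mem_pi, mem_ofPred_eq, mem_univ, forall_const, mem_prod, mem_Ici]
  rw [h]
  exact MeasurableSet.univ_pi fun i => measurableSet_Ici.prod measurableSet_Ici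

@[fun_prop]
theorem measurable_multipleIntegrand (H : ℝ) (n : ℕ) : Measurable (multipleIntegrand H n) := by
  unfold multipleIntegrand
  fun_prop

theorem multipleIntegrand_nonneg (H : ℝ) {n : ℕ} {z : Fin n → ℝ × ℝ} (hz : z ∈ orthant n) :
    0 ≤ multipleIntegrand H n z := by
  have h1 : 0 ≤ ∑ i, (z i).1 := Finset.sum_nonneg fun i _ => (hz i).1
  have h2 : 0 ≤ ∑ i, (z i).2 := Finset.sum_nonneg fun i _ => (hz i).2
  unfold multipleIntegrand
  exact div_nonneg (Finset.prod_nonneg fun i _ => Real.rpow_nonneg (abs_nonneg _) _)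
    (by positivity)

theorem lintegral_prod_expKernel {a r : ℝ} (ha : -1 < a) (hr : 0 < r) (n : ℕ) :
    ∫⁻ z in orthant n, ENNReal.ofReal (∏ i, expKernel a r (z i)) =
      ENNReal.ofReal (((1 / r) ^ (a + 2) * Real.Gamma (a + 1)) ^ n) := by
  rw [restrict_orthant, ← ofReal_integral_eq_lintegral_ofReal, integral_fintype_prod_eq_prod,
    integral_expKernel ha hr]
  · simp
  · exact Integrable.fintype_prod fun i => integrableOn_expKernel ha hr
  · exact ae_of_all _ fun z => Finset.prod_nonneg fun i _ => expKernel_nonneg a r _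

/-- The denominator is replaced by its Gamma integral in $r$ and Tonelli swaps the order. Working
with values in `ℝ≥0∞` needs no prior convergence, which is then read off from the finite right-hand
side. -/
theorem lintegral_multipleIntegrand {H : ℝ} (hH : 1 / 2 < H) (n : ℕ) :
    ENNReal.ofReal (Real.Gamma (2 * n * H + 1)) *
        ∫⁻ z in orthant n, ENNReal.ofReal (multipleIntegrand H n z) =
      ENNReal.ofReal (Real.Gamma (2 * H - 1) ^ n) := by
  have hA : 0 < 2 * (n : ℝ) * H + 1 := by positivity
  have hG := Real.Gamma_pos_of_pos hA
  rw [← lintegral_const_mul _ (by fun_prop)]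
  have h1 : ∫⁻ z in orthant n, ENNReal.ofReal (Real.Gamma (2 * n * H + 1)) *
        ENNReal.ofReal (multipleIntegrand H n z) =
      ∫⁻ z in orthant n, ∫⁻ r in Ioi (0 : ℝ),
        ENNReal.ofReal (r ^ (2 * n * H) * Real.exp (-r)) *
          ENNReal.ofReal (∏ i, expKernel (2 * H - 2) r (z i)) := by
    refine setLIntegral_congr_fun (measurableSet_orthant n) fun z hz => ?_
    have hz1 : 0 ≤ ∑ i, (z i).1 := Finset.sum_nonneg fun i _ => (hz i).1
    have hz2 : 0 ≤ ∑ i, (z i).2 := Finset.sum_nonneg fun i _ => (hz i).2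
    have hS : 0 < 1 + ∑ i, (z i).1 + ∑ i, (z i).2 := by positivity
    have hP : 0 ≤ ∏ i, |(z i).1 - (z i).2| ^ (2 * H - 2) :=
      Finset.prod_nonneg fun i _ => Real.rpow_nonneg (abs_nonneg _) _
    have hb := lintegral_rpow_sub_one_mul_exp hA hS
    have h2 : ∀ r ∈ Ioi (0 : ℝ), ENNReal.ofReal (r ^ (2 * n * H) * Real.exp (-r)) *
          ENNReal.ofReal (∏ i, expKernel (2 * H - 2) r (z i)) =
        ENNReal.ofReal (∏ i, |(z i).1 - (z i).2| ^ (2 * H - 2)) *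
          ENNReal.ofReal (r ^ (2 * n * H + 1 - 1) *
            Real.exp (-((1 + ∑ i, (z i).1 + ∑ i, (z i).2) * r))) := by
      intro r hr
      have hr' : 0 ≤ r := le_of_lt hr
      rw [← ENNReal.ofReal_mul (by positivity), ← ENNReal.ofReal_mul hP]
      congr 1
      simp only [expKernel, Finset.prod_mul_distrib, ← Real.exp_sum, add_sub_cancel_right,
        Finset.sum_neg_distrib, ← Finset.mul_sum, Finset.sum_add_distrib]
      rw [show -((1 + ∑ i, (z i).1 + ∑ i, (z i).2) * r) =
        -r + -(r * (∑ i, (z i).1 + ∑ i, (z i).2)) by ring, Real.exp_add]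
      ring
    rw [setLIntegral_congr_fun measurableSet_Ioi h2, lintegral_const_mul _ (by fun_prop), hb,
      ← ENNReal.ofReal_mul hG.le, ← ENNReal.ofReal_mul hP]
    congr 1
    rw [multipleIntegrand, one_div, Real.inv_rpow hS.le]
    ring_nf
  rw [h1, lintegral_lintegral_swap]
  -- Each pair contributes $r^{-2H}$ by scaling, so the $n$ pairs cancel $r^{2nH}$ exactly. The
  -- remaining $e^{-r}$ is written as the integrand of $\Gamma(1)$.
  · have h3 : ∀ r ∈ Ioi (0 : ℝ), ∫⁻ z in orthant n,
        ENNReal.ofReal (r ^ (2 * n * H) * Real.exp (-r)) *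
          ENNReal.ofReal (∏ i, expKernel (2 * H - 2) r (z i)) =
        ENNReal.ofReal (r ^ ((1 : ℝ) - 1) * Real.exp (-(1 * r))) *
          ENNReal.ofReal (Real.Gamma (2 * H - 1) ^ n) := by
      intro r hr
      have hr' : 0 < r := hr
      rw [lintegral_const_mul _ (by fun_prop), lintegral_prod_expKernel (by linarith) hr,
        ← ENNReal.ofReal_mul (by positivity), ← ENNReal.ofReal_mul (by positivity)]
      congr 1
      rw [mul_pow, show 2 * H - 2 + 1 = 2 * H - 1 by ring, show 2 * H - 2 + 2 = 2 * H by ring,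
        ← Real.rpow_mul_natCast (by positivity), one_div, Real.inv_rpow hr'.le,
        show 2 * H * n = 2 * n * H by ring, sub_self, Real.rpow_zero, one_mul, one_mul]
      have : r ^ (2 * n * H) ≠ 0 := by positivity
      field_simp
    rw [setLIntegral_congr_fun measurableSet_Ioi h3, lintegral_mul_const _ (by fun_prop),
      lintegral_rpow_sub_one_mul_exp one_pos one_pos]
    simp
  · simp only [expKernel]
    fun_prop

theorem integrableOn_multipleIntegrand {H : ℝ} (hH : 1 / 2 < H) (n : ℕ) :
    IntegrableOn (multipleIntegrand H n) (orthant n) := by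
  have hG := Real.Gamma_pos_of_pos (show 0 < 2 * (n : ℝ) * H + 1 by positivity)
  refine (lintegral_ofReal_ne_top_iff_integrable (by fun_prop)
    ((ae_restrict_mem (measurableSet_orthant n)).mono
      fun z hz => multipleIntegrand_nonneg H hz)).1 fun h => ?_
  have := lintegral_multipleIntegrand hH n
  rw [h, ENNReal.mul_top (by simpa using hG)] at this
  exact ENNReal.ofReal_ne_top this.symm

theorem integral_multipleIntegrand {H : ℝ} (hH : 1 / 2 < H) (n : ℕ) :
    Real.Gamma (2 * n * H + 1) * ∫ z in orthant n, multipleIntegrand H n z =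
      Real.Gamma (2 * H - 1) ^ n := by
  have hG := Real.Gamma_pos_of_pos (show 0 < 2 * (n : ℝ) * H + 1 by positivity)
  have hG' := Real.Gamma_pos_of_pos (show 0 < 2 * H - 1 by linarith)
  rw [integral_eq_lintegral_of_nonneg_ae ((ae_restrict_mem (measurableSet_orthant n)).mono
      fun z hz => multipleIntegrand_nonneg H hz) (by fun_prop)]
  have := congrArg ENNReal.toReal (lintegral_multipleIntegrand hH n)
  rwa [ENNReal.toReal_mul, ENNReal.toReal_ofReal hG.le, ENNReal.toReal_ofReal (by positivity)]
    at this

theorem varianceAtInfinity_eq {H θ : ℝ} (hH : 1 / 2 < H) :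
    varianceAtInfinity H θ =
      H * (2 * H - 1) * (θ ^ (2 * H) * Real.Gamma (2 * H - 1)) := by
  have : Real.Gamma (2 * H) = (2 * H - 1) * Real.Gamma (2 * H - 1) := by
    rw [← Real.Gamma_add_one (by linarith)]
    congr 1
    ring
  rw [varianceAtInfinity, this]
  ring

theorem momentAtInfinity_eq_multipleIntegral {H θ : ℝ} (hH : 1 / 2 < H) (hθ : 0 < θ) (n : ℕ) :
    momentAtInfinity H θ n =
      2 ^ n * Real.Gamma ((2 * (n : ℝ) + 1) / 2) / √Real.pi *
        (H ^ n * (2 * H - 1) ^ n * Real.Gamma (2 * n * H + 1) * θ ^ (2 * n * H) *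
          ∫ z in orthant n, multipleIntegrand H n z) := by
  rw [momentAtInfinity, varianceAtInfinity_eq hH]
  congr 1
  rw [mul_pow, mul_pow, mul_pow, ← integral_multipleIntegrand hH n,
    ← Real.rpow_mul_natCast hθ.le, show 2 * H * n = 2 * n * H by ring]
  ring

/-! ### Even moments of the centred Gaussian law -/

theorem integral_even_pow_gaussianReal (n : ℕ) (v : ℝ≥0) :
    ∫ x, |x| ^ (2 * n) ∂gaussianReal 0 v =
      2 ^ n * Real.Gamma ((2 * (n : ℝ) + 1) / 2) / √Real.pi * (v : ℝ) ^ n := by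
  have hpi : √Real.pi ≠ 0 := by positivity
  -- Zero variance is a Dirac mass without density. There $n=0$ rests on $\Gamma(1/2)=\sqrt\pi$.
  by_cases hv : v = 0
  · subst hv
    rcases Nat.eq_zero_or_pos n with rfl | hn
    · have : Real.Gamma 2⁻¹ = √Real.pi := by simpa using Real.Gamma_one_half_eq
      simp [this, hpi]
    · simp [hn.ne']
  have hv' : 0 < (v : ℝ) := by positivity
  rw [integral_gaussianReal_eq_integral_smul hv]
  have h1 : ∀ x : ℝ, gaussianPDFReal 0 v x • |x| ^ (2 * n) =
      (√(2 * Real.pi * v))⁻¹ *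
        (fun y : ℝ => y ^ (2 * (n : ℝ)) * Real.exp (-(2 * (v : ℝ))⁻¹ * y ^ (2 : ℝ))) |x| := by
    intro x
    have : |x| ^ (2 * (n : ℝ)) = |x| ^ (2 * n) := by
      rw [← Real.rpow_natCast]
      push_cast
      rfl
    simp only [gaussianPDFReal, this, Real.rpow_two, sq_abs, sub_zero, smul_eq_mul]
    rw [show -(2 * (v : ℝ))⁻¹ * x ^ 2 = -x ^ 2 / (2 * v) by ring]
    ring
  simp_rw [h1]
  rw [integral_const_mul, integral_comp_abs
    (f := fun y : ℝ => y ^ (2 * (n : ℝ)) * Real.exp (-(2 * (v : ℝ))⁻¹ * y ^ (2 : ℝ))),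
    integral_rpow_mul_exp_neg_mul_rpow two_pos
      (by have : (0 : ℝ) ≤ n := n.cast_nonneg
          linarith) (by positivity)]
  have h2 : ((2 * (v : ℝ))⁻¹) ^ (-(2 * (n : ℝ) + 1) / 2) = (2 * (v : ℝ)) ^ n * √(2 * v) := by
    rw [Real.inv_rpow (by positivity), ← Real.rpow_neg (by positivity), Real.sqrt_eq_rpow,
      ← Real.rpow_natCast, ← Real.rpow_add (by positivity)]
    congr 1
    ring
  have h3 : √(2 * Real.pi * v) = √(2 * v) * √Real.pi := by
    rw [← Real.sqrt_mul (by positivity)]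
    congr 1
    ring
  rw [h2, h3]
  have : √(2 * (v : ℝ)) ≠ 0 := by positivity
  rw [mul_pow]
  field_simp

end

section

/-! ### Riemann–Stieltjes integrals of smooth integrands against continuous paths -/

/-- Integrating by parts on `[a, ξ]` and `[ξ, b]`, with `G` recentred at `G a` and at `G b`, makes
the cell error an exact sum of two integrals. Only a bound on `F'` and the oscillation of `G` enter,
so no bounded variation of the path is needed. -/
theorem abs_riemannStieltjes_term_sub_le {F F' G : ℝ → ℝ} (hF : ∀ x, HasDerivAt F (F' x) x)
    (hF' : Continuous F') (hG : Continuous G) {a ξ b η M : ℝ} (haξ : a ≤ ξ) (hξb : ξ ≤ b)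
    (hM : ∀ s ∈ Icc a b, |F' s| ≤ M) (ha : ∀ s ∈ Icc a ξ, |G s - G a| ≤ η)
    (hb : ∀ s ∈ Icc ξ b, |G s - G b| ≤ η) :
    |F ξ * (G b - G a) - (F b * G b - F a * G a - ∫ s in a..b, F' s * G s)| ≤
      M * η * (b - a) := by
  have hi : ∀ (c x y : ℝ), IntervalIntegrable (fun s => F' s * (G s - c)) volume x y :=
    fun c x y => (hF'.mul (hG.sub continuous_const)).intervalIntegrable _ _
  have hi' : ∀ (x y : ℝ), IntervalIntegrable (fun s => F' s * G s) volume x y :=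
    fun x y => (hF'.mul hG).intervalIntegrable _ _
  have hi'' : ∀ (x y : ℝ), IntervalIntegrable F' volume x y :=
    fun x y => hF'.intervalIntegrable _ _
  have hsplit : ∀ c x y : ℝ, ∫ s in x..y, F' s * (G s - c) =
      (∫ s in x..y, F' s * G s) - (F y - F x) * c := by
    intro c x y
    simp_rw [mul_sub]
    rw [intervalIntegral.integral_sub (hi' x y) ((hi'' x y).mul_const c),
      intervalIntegral.integral_mul_const,
      intervalIntegral.integral_eq_sub_of_hasDerivAt (fun z _ => hF z) (hi'' x y)]
  have hM0 : 0 ≤ M := (abs_nonneg _).trans (hM a ⟨le_rfl, haξ.trans hξb⟩)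
  have e : F ξ * (G b - G a) - (F b * G b - F a * G a - ∫ s in a..b, F' s * G s) =
      (∫ s in a..ξ, F' s * (G s - G a)) + ∫ s in ξ..b, F' s * (G s - G b) := by
    rw [hsplit, hsplit, ← intervalIntegral.integral_add_adjacent_intervals (hi' a ξ) (hi' ξ b)]
    ring
  have h1 : |∫ s in a..ξ, F' s * (G s - G a)| ≤ M * η * (ξ - a) := by
    have := intervalIntegral.norm_integral_le_of_norm_le_const
      (f := fun s => F' s * (G s - G a)) (C := M * η) (a := a) (b := ξ) fun s hs => by
        rw [uIoc_of_le haξ] at hs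
        rw [Real.norm_eq_abs, abs_mul]
        exact mul_le_mul (hM s ⟨hs.1.le, hs.2.trans hξb⟩) (ha s ⟨hs.1.le, hs.2⟩)
          (abs_nonneg _) hM0
    rwa [Real.norm_eq_abs, abs_of_nonneg (sub_nonneg.2 haξ)] at this
  have h2 : |∫ s in ξ..b, F' s * (G s - G b)| ≤ M * η * (b - ξ) := by
    have := intervalIntegral.norm_integral_le_of_norm_le_const
      (f := fun s => F' s * (G s - G b)) (C := M * η) (a := ξ) (b := b) fun s hs => by
        rw [uIoc_of_le hξb] at hs
        rw [Real.norm_eq_abs, abs_mul]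
        exact mul_le_mul (hM s ⟨haξ.trans hs.1.le, hs.2⟩) (hb s ⟨hs.1.le, hs.2⟩)
          (abs_nonneg _) hM0
    rwa [Real.norm_eq_abs, abs_of_nonneg (sub_nonneg.2 hξb)] at this
  rw [e]
  calc _ ≤ _ := abs_add_le _ _
    _ ≤ M * η * (ξ - a) + M * η * (b - ξ) := add_le_add h1 h2
    _ = _ := by ring

/-- Integration by parts for a smooth integrand and a continuous path. -/
def byPartsIntegral (F F' : ℝ → ℝ) (g : ℝ≥0 → ℝ) (t : ℝ) : ℝ :=
  F t * g t.toNNReal - F 0 * g 0 - ∫ s in (0 : ℝ)..t, F' s * g s.toNNReal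

theorem continuous_byPartsIntegral {F F' : ℝ → ℝ} (hF : ∀ x, HasDerivAt F (F' x) x)
    (hF' : Continuous F') {g : ℝ≥0 → ℝ} (hg : Continuous g) :
    Continuous (byPartsIntegral F F' g) := by
  have hFc : Continuous F := continuous_iff_continuousAt.2 fun x => (hF x).continuousAt
  have hG : Continuous fun s : ℝ => F' s * g s.toNNReal :=
    hF'.mul (hg.comp continuous_real_toNNReal)
  have : Continuous fun t : ℝ => ∫ s in (0 : ℝ)..t, F' s * g s.toNNReal :=
    intervalIntegral.continuous_primitive (fun a b => hG.intervalIntegrable a b) 0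
  unfold byPartsIntegral
  fun_prop

theorem isRiemannStieltjesIntegral_byParts {F F' : ℝ → ℝ} (hF : ∀ x, HasDerivAt F (F' x) x)
    (hF' : Continuous F') {g : ℝ≥0 → ℝ} (hg : Continuous g) (t : ℝ≥0) :
    IsRiemannStieltjesIntegral (fun s => F s) g t (byPartsIntegral F F' g t) := by
  intro ε hε
  set G : ℝ → ℝ := fun s => g s.toNNReal with hGdef
  have hG : Continuous G := hg.comp continuous_real_toNNReal
  have hi' : ∀ (x y : ℝ), IntervalIntegrable (fun s => F' s * G s) volume x y :=
    fun x y => (hF'.mul hG).intervalIntegrable _ _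
  obtain ⟨M, hM⟩ := (isCompact_Icc (a := (0 : ℝ)) (b := t)).exists_bound_of_continuousOn
    hF'.continuousOn
  have hM0 : 0 ≤ M := (norm_nonneg _).trans (hM 0 ⟨le_rfl, t.2⟩)
  -- The `+ 1` keeps the denominator positive when `M * t = 0` and makes the final inequality
  -- strict.
  have hc : 0 < M * t + 1 := by positivity
  obtain ⟨δ, hδ, hUC⟩ := Metric.uniformContinuousOn_iff.1
    ((isCompact_Icc (a := (0 : ℝ)) (b := t)).uniformContinuousOn_of_continuous hG.continuousOn)
    (ε / (M * t + 1)) (by positivity)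
  refine ⟨δ, hδ, fun m p ξ hp0 hpm hp => ?_⟩
  -- The partition is only known to increase step by step, so the bound is propagated backwards from
  -- `p m = t`.
  have hle : ∀ d ≤ m, p (m - d) ≤ t := by
    intro d
    induction d with
    | zero => intro _; simp [hpm]
    | succ d ih =>
      intro hd
      have h := hp (m - (d + 1)) (by omega)
      rw [show m - (d + 1) + 1 = m - d by omega] at h
      exact (h.1.trans h.2.1).trans (ih (by omega))
  have hle' : ∀ k ≤ m, p k ≤ t := fun k hk => by
    have := hle (m - k) (by omega)
    rwa [show m - (m - k) = k by omega] at this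
  set A : ℝ → ℝ := fun s => F s * G s - ∫ r in (0 : ℝ)..s, F' r * G r with hA
  have hGp : ∀ s : ℝ≥0, G s = g s := fun s => by simp [hGdef]
  have htel : byPartsIntegral F F' g t =
      ∑ k ∈ Finset.range m, (A (p (k + 1)) - A (p k)) := by
    rw [Finset.sum_range_sub (fun k => A (p k)), hp0, hpm]
    simp only [byPartsIntegral, hA, NNReal.coe_zero, intervalIntegral.integral_same, hGdef,
      Real.toNNReal_zero]
    ring
  rw [htel, ← Finset.sum_sub_distrib]
  have hterm : ∀ k ∈ Finset.range m,
      |F (ξ k) * (g (p (k + 1)) - g (p k)) - (A (p (k + 1)) - A (p k))| ≤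
        M * (ε / (M * t + 1)) * ((p (k + 1) : ℝ) - p k) := by
    intro k hk
    have hk' := Finset.mem_range.1 hk
    obtain ⟨h1, h2, h3⟩ := hp k hk'
    have h1' : (p k : ℝ) ≤ ξ k := h1
    have h2' : (ξ k : ℝ) ≤ p (k + 1) := h2
    have h4 : (p (k + 1) : ℝ) ≤ t := hle' (k + 1) hk'
    have h0 : (0 : ℝ) ≤ p k := (p k).2
    have := abs_riemannStieltjes_term_sub_le hF hF' hG (a := p k) (ξ := ξ k) (b := p (k + 1))
      (η := ε / (M * t + 1)) (M := M) h1 h2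
      (fun s hs => hM s ⟨h0.trans hs.1, hs.2.trans h4⟩)
      (fun s hs => by
        rw [← Real.dist_eq]
        refine (hUC s ⟨h0.trans hs.1, hs.2.trans (h2'.trans h4)⟩ _
          ⟨h0, h1'.trans (h2'.trans h4)⟩ ?_).le
        rw [Real.dist_eq, abs_of_nonneg (sub_nonneg.2 hs.1)]
        linarith [hs.2])
      (fun s hs => by
        rw [← Real.dist_eq]
        refine (hUC s ⟨(h0.trans h1').trans hs.1, hs.2.trans h4⟩ _
          ⟨h0.trans (h1'.trans h2'), h4⟩ ?_).le
        rw [Real.dist_eq, abs_sub_comm, abs_of_nonneg (sub_nonneg.2 hs.2)]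
        linarith [hs.1])
    refine le_of_eq_of_le ?_ this
    congr 1
    rw [hGp, hGp]
    simp only [hA, hGp]
    rw [← intervalIntegral.integral_interval_sub_left (hi' 0 (p (k + 1))) (hi' 0 (p k))]
    ring
  calc _ ≤ _ := Finset.abs_sum_le_sum_abs _ _
    _ ≤ _ := Finset.sum_le_sum hterm
    _ = M * (ε / (M * t + 1)) * t := by
      rw [← Finset.mul_sum, Finset.sum_range_sub (fun k => (p k : ℝ)), hp0, hpm]
      simp
    _ < ε := by
      rw [show M * (ε / (M * t + 1)) * t = ε * (M * t / (M * t + 1)) by ring]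
      refine mul_lt_of_lt_one_right hε ?_
      rw [div_lt_one hc]
      linarith

/-- The left-point Riemann–Stieltjes sum over the uniform partition of `[0, t]` into `m` cells. -/
def leftSum (f g : ℝ≥0 → ℝ) (t : ℝ≥0) (m : ℕ) : ℝ :=
  ∑ k ∈ Finset.range m,
    f (k * t / m) * (g (((k + 1 : ℕ) : ℝ≥0) * t / m) - g (k * t / m))

theorem IsRiemannStieltjesIntegral.tendsto_leftSum {f g : ℝ≥0 → ℝ} {t : ℝ≥0} {I : ℝ}
    (h : IsRiemannStieltjesIntegral f g t I) : Tendsto (leftSum f g t) atTop (𝓝 I) := by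
  rw [Metric.tendsto_atTop]
  intro ε hε
  obtain ⟨δ, hδ, hI⟩ := h ε hε
  obtain ⟨N, hN⟩ := exists_nat_gt ((t : ℝ) / δ)
  refine ⟨N + 1, fun m hm => ?_⟩
  have hm0 : (0 : ℝ) < m := by
    have : 0 < m := by omega
    exact_mod_cast this
  have hm0' : (m : ℝ≥0) ≠ 0 := by
    have : m ≠ 0 := by omega
    exact_mod_cast this
  rw [Real.dist_eq]
  refine hI m (fun k => k * t / m) (fun k => k * t / m) (by simp) (by field_simp)
    fun k _ => ⟨le_rfl, ?_, ?_⟩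
  · gcongr
    omega
  · have hNm : (N : ℝ) ≤ m := by exact_mod_cast (by omega : N ≤ m)
    push_cast
    rw [← sub_div, show ((k : ℝ) + 1) * t - k * t = t by ring, div_lt_iff₀ hm0]
    rw [div_lt_iff₀ hδ] at hN
    nlinarith

/-- The integral is defined by choice; it is unique because any two candidates are limits of the
same left-point sums. -/
theorem IsRiemannStieltjesIntegral.riemannStieltjes_eq {f g : ℝ≥0 → ℝ} {t : ℝ≥0} {I : ℝ}
    (h : IsRiemannStieltjesIntegral f g t I) : riemannStieltjes f g t = I := by
  have hex : ∃ I, IsRiemannStieltjesIntegral f g t I := ⟨I, h⟩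
  rw [riemannStieltjes, dif_pos hex]
  exact tendsto_nhds_unique hex.choose_spec.tendsto_leftSum h.tendsto_leftSum

/-! ### Paths of the fractional Ornstein–Uhlenbeck process -/

variable {Ω : Type*}

theorem hasDerivAt_exp_div (θ x : ℝ) :
    HasDerivAt (fun s : ℝ => Real.exp (s / θ)) (Real.exp (x / θ) * (1 / θ)) x :=
  ((hasDerivAt_id x).div_const θ).exp

theorem fOU_eq_byParts {θ : ℝ} {B : ℝ≥0 → Ω → ℝ} {ω : Ω} (h : Continuous fun t => B t ω)
    (t : ℝ≥0) :
    fOU θ B t ω = Real.exp (-(t : ℝ) / θ) *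
      byPartsIntegral (fun s => Real.exp (s / θ)) (fun s => Real.exp (s / θ) * (1 / θ))
        (fun s => B s ω) t := by
  rw [fOU, (isRiemannStieltjesIntegral_byParts (hasDerivAt_exp_div θ) (by fun_prop)
    h t).riemannStieltjes_eq]

theorem continuous_fOU {θ : ℝ} {B : ℝ≥0 → Ω → ℝ} {ω : Ω} (h : Continuous fun t => B t ω) :
    Continuous fun t => fOU θ B t ω := by
  have := continuous_byPartsIntegral (hasDerivAt_exp_div θ) (by fun_prop) h
  simp_rw [fOU_eq_byParts h]
  fun_prop

theorem tendsto_leftSum_fOU {θ : ℝ} {B : ℝ≥0 → Ω → ℝ} {ω : Ω}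
    (h : Continuous fun t => B t ω) (t : ℝ≥0) :
    Tendsto (fun m => Real.exp (-(t : ℝ) / θ) *
      leftSum (fun s => Real.exp ((s : ℝ) / θ)) (fun s => B s ω) t m) atTop
      (𝓝 (fOU θ B t ω)) := by
  rw [fOU_eq_byParts h]
  exact (isRiemannStieltjesIntegral_byParts (hasDerivAt_exp_div θ) (by fun_prop)
    h t).tendsto_leftSum.const_mul _

end

section

/-! ### The covariance kernel of fractional Brownian motion -/

theorem intervalIntegrable_abs_rpow {a : ℝ} (ha : -1 < a) (x y : ℝ) :
    IntervalIntegrable (fun w : ℝ => |w| ^ a) volume x y := by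
  have hpos : ∀ c : ℝ, 0 ≤ c → IntervalIntegrable (fun w : ℝ => |w| ^ a) volume 0 c := by
    intro c hc
    refine (intervalIntegral.intervalIntegrable_rpow' ha).congr fun w hw => ?_
    rw [uIoc_of_le hc] at hw
    rw [abs_of_pos hw.1]
  have hall : ∀ c : ℝ, IntervalIntegrable (fun w : ℝ => |w| ^ a) volume 0 c := by
    intro c
    rcases le_total 0 c with hc | hc
    · exact hpos c hc
    · rw [IntervalIntegrable.iff_comp_neg, neg_zero]
      simp_rw [abs_neg]
      exact hpos _ (by linarith)
  exact (hall x).symm.trans (hall y)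

/-- Up to the factor $p$ this is the derivative of $|x|^p$, which is $C^1$ for $p>1$; this settles
continuity at $0$ even when $p-2<0$. -/
theorem continuous_abs_rpow_mul_self {p : ℝ} (hp : 1 < p) :
    Continuous fun x : ℝ => |x| ^ (p - 2) * x := by
  have h := (contDiff_norm_rpow (E := ℝ) hp).continuous_deriv le_rfl
  have h2 : (fun x : ℝ => |x| ^ (p - 2) * x) =
      fun x => p⁻¹ * deriv (fun y : ℝ => ‖y‖ ^ p) x := by
    funext x
    rw [(hasDerivAt_norm_rpow x hp).deriv, Real.norm_eq_abs, ← mul_assoc, ← mul_assoc,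
      inv_mul_cancel₀ (by linarith), one_mul]
  rw [h2]
  fun_prop

theorem integral_abs_rpow {p : ℝ} (hp : 1 < p) (x y : ℝ) :
    ∫ w in x..y, |w| ^ (p - 2) = (|y| ^ (p - 2) * y - |x| ^ (p - 2) * x) / (p - 1) := by
  have hp1 : p - 1 ≠ 0 := by linarith
  rw [sub_div]
  refine integral_eq_of_hasDerivAt_off_countable
    (fun w => |w| ^ (p - 2) * w / (p - 1)) _ (countable_singleton 0)
    ((continuous_abs_rpow_mul_self hp).div_const _).continuousOn (fun w hw => ?_)
    (intervalIntegrable_abs_rpow (by linarith) _ _)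
  have hw0 : w ≠ 0 := fun h => hw.2 (by simpa using h)
  have h1 := (((hasDerivAt_abs hw0).rpow_const (p := p - 2)
    (Or.inl (abs_ne_zero.2 hw0))).mul (hasDerivAt_id w)).div_const (p - 1)
  refine h1.congr_deriv ?_
  have h2 : |w| ^ (p - 2 - 1) * |w| = |w| ^ (p - 2) := by
    rw [Real.rpow_sub_one (abs_ne_zero.2 hw0), div_mul_cancel₀ _ (abs_ne_zero.2 hw0)]
  have h3 : (SignType.sign w : ℝ) * w = |w| := sign_mul_self w
  rw [div_eq_iff hp1]
  simp only [id, mul_one]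
  rw [← h2, ← h3]
  ring

/-- With $p=2H$, antidifferentiating the singular kernel twice produces the covariance of fractional
Brownian motion. -/
theorem integral_integral_abs_sub_rpow {p : ℝ} (hp : 1 < p) (s t : ℝ) :
    ∫ u in (0 : ℝ)..s, ∫ v in (0 : ℝ)..t, |u - v| ^ (p - 2) =
      (|s| ^ p + |t| ^ p - |s - t| ^ p) / (p * (p - 1)) := by
  have hp1 : p - 1 ≠ 0 := by linarith
  have hp0 : p ≠ 0 := by linarith
  have hc := continuous_abs_rpow_mul_self hp
  have hD : ∀ x y : ℝ, ∫ u in x..y, |u| ^ (p - 2) * u = (|y| ^ p - |x| ^ p) / p := by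
    intro x y
    rw [sub_div]
    refine intervalIntegral.integral_eq_sub_of_hasDerivAt (f := fun u => |u| ^ p / p)
      (fun u _ => ?_) (hc.intervalIntegrable _ _)
    refine ((hasDerivAt_abs_rpow u hp).div_const p).congr_deriv ?_
    field_simp
  have hinner : ∀ u : ℝ, ∫ v in (0 : ℝ)..t, |u - v| ^ (p - 2) =
      (|u| ^ (p - 2) * u) / (p - 1) - (|u - t| ^ (p - 2) * (u - t)) / (p - 1) := by
    intro u
    rw [intervalIntegral.integral_comp_sub_left (fun w => |w| ^ (p - 2)), integral_abs_rpow hp,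
      sub_zero, sub_div]
  simp_rw [hinner]
  have hc' : Continuous fun u : ℝ => |u - t| ^ (p - 2) * (u - t) :=
    hc.comp (continuous_id.sub continuous_const)
  rw [intervalIntegral.integral_sub ((hc.div_const _).intervalIntegrable _ _)
    ((hc'.div_const _).intervalIntegrable _ _), intervalIntegral.integral_div,
    intervalIntegral.integral_div,
    intervalIntegral.integral_comp_sub_right (fun w => |w| ^ (p - 2) * w), hD, hD, zero_sub,
    abs_neg, abs_zero, Real.zero_rpow hp0]
  field_simp
  ring

/-- The kernel `|u - v|^{2H-2}`. -/
def covKernel (H : ℝ) (z : ℝ × ℝ) : ℝ := |z.1 - z.2| ^ (2 * H - 2)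

theorem covKernel_nonneg (H : ℝ) (z : ℝ × ℝ) : 0 ≤ covKernel H z :=
  Real.rpow_nonneg (abs_nonneg _) _

@[fun_prop]
theorem measurable_covKernel (H : ℝ) : Measurable (covKernel H) := by
  unfold covKernel
  fun_prop

theorem integrableOn_covKernel {H : ℝ} (hH : 1 / 2 < H) (s t : ℝ) :
    IntegrableOn (covKernel H) (Ioc 0 s ×ˢ Ioc 0 t) := by
  have h := (integrableOn_expKernel (a := 2 * H - 2) (by linarith) one_pos).mono_set
    (show Ioc (0 : ℝ) s ×ˢ Ioc (0 : ℝ) t ⊆ Ioi 0 ×ˢ Ioi 0 from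
      prod_mono (fun x hx => hx.1) fun x hx => hx.1)
  refine (h.const_mul (Real.exp (s + t))).mono' (by fun_prop) ?_
  refine (ae_restrict_mem (measurableSet_Ioc.prod measurableSet_Ioc)).mono fun z hz => ?_
  rw [Real.norm_eq_abs, abs_of_nonneg (covKernel_nonneg H z), expKernel, one_mul, mul_left_comm,
    ← Real.exp_add]
  refine le_mul_of_one_le_right (covKernel_nonneg H z) (Real.one_le_exp ?_)
  linarith [hz.1.2, hz.2.2]

theorem setIntegral_covKernel {H : ℝ} (hH : 1 / 2 < H) (s t : ℝ≥0) :
    H * (2 * H - 1) * ∫ z in Ioc (0 : ℝ) s ×ˢ Ioc (0 : ℝ) t, covKernel H z =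
      1 / 2 * ((s : ℝ) ^ (2 * H) + (t : ℝ) ^ (2 * H) - |(s : ℝ) - t| ^ (2 * H)) := by
  have h := integrableOn_covKernel hH s t
  rw [Measure.volume_eq_prod] at h ⊢
  rw [setIntegral_prod _ h, ← intervalIntegral.integral_of_le (NNReal.coe_nonneg s)]
  simp_rw [← intervalIntegral.integral_of_le (NNReal.coe_nonneg t)]
  simp only [covKernel]
  rw [integral_integral_abs_sub_rpow (by linarith), abs_of_nonneg (NNReal.coe_nonneg s),
    abs_of_nonneg (NNReal.coe_nonneg t)]
  have h1 : H * 2 - 1 ≠ 0 := by linarith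
  have h2 : H ≠ 0 := by linarith
  field_simp

/-- The indicator function of `(0, s]`. -/
def step (s : ℝ≥0) : ℝ → ℝ := (Ioc (0 : ℝ) s).indicator 1

@[fun_prop]
theorem measurable_step (s : ℝ≥0) : Measurable (step s) :=
  measurable_one.indicator measurableSet_Ioc

theorem step_mul_step_mul_covKernel (H : ℝ) (s t : ℝ≥0) :
    (fun z : ℝ × ℝ => step s z.1 * step t z.2 * covKernel H z) =
      (Ioc (0 : ℝ) s ×ˢ Ioc (0 : ℝ) t).indicator (covKernel H) := by
  funext z
  by_cases h1 : z.1 ∈ Ioc (0 : ℝ) s <;> by_cases h2 : z.2 ∈ Ioc (0 : ℝ) t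
  · rw [indicator_of_mem (mk_mem_prod h1 h2)]
    simp [step, indicator_of_mem h1, indicator_of_mem h2]
  all_goals
    rw [indicator_of_notMem (by simp only [mem_prod]; tauto)]
    simp [step, h1, h2]

theorem integrable_step_mul_step_mul_covKernel {H : ℝ} (hH : 1 / 2 < H) (s t : ℝ≥0) :
    Integrable fun z : ℝ × ℝ => step s z.1 * step t z.2 * covKernel H z := by
  rw [step_mul_step_mul_covKernel,
    integrable_indicator_iff (measurableSet_Ioc.prod measurableSet_Ioc)]
  exact integrableOn_covKernel hH s t

variable {Ω : Type*} [MeasurableSpace Ω]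

theorem IsFractionalBrownianMotion.memLp {P : Measure Ω} {H : ℝ} {B : ℝ≥0 → Ω → ℝ}
    (hB : IsFractionalBrownianMotion P H B) (t : ℝ≥0) : MemLp (B t) 2 P :=
  (hB.gaussian.hasGaussianLaw_eval t).memLp_two

theorem IsFractionalBrownianMotion.integral_mul {P : Measure Ω} {H : ℝ} (hH : 1 / 2 < H)
    {B : ℝ≥0 → Ω → ℝ} (hB : IsFractionalBrownianMotion P H B) (s t : ℝ≥0) :
    ∫ ω, B s ω * B t ω ∂P =
      H * (2 * H - 1) * ∫ z : ℝ × ℝ, step s z.1 * step t z.2 * covKernel H z := by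
  rw [step_mul_step_mul_covKernel,
    integral_indicator (measurableSet_Ioc.prod measurableSet_Ioc), setIntegral_covKernel hH,
    hB.covariance]

theorem integral_sub_sub_sub {α : Type*} [MeasurableSpace α] {μ : Measure α} {f g h k : α → ℝ}
    (hf : Integrable f μ) (hg : Integrable g μ) (hh : Integrable h μ) (hk : Integrable k μ) :
    ∫ a, (f a - g a - (h a - k a)) ∂μ =
      (∫ a, f a ∂μ) - (∫ a, g a ∂μ) - ((∫ a, h a ∂μ) - ∫ a, k a ∂μ) := by
  rw [← integral_sub hf hg, ← integral_sub hh hk]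
  exact integral_sub (hf.sub hg) (hh.sub hk)

theorem IsFractionalBrownianMotion.integral_increment_mul {P : Measure Ω} {H : ℝ}
    (hH : 1 / 2 < H) {B : ℝ≥0 → Ω → ℝ} (hB : IsFractionalBrownianMotion P H B)
    (s s' t t' : ℝ≥0) :
    ∫ ω, (B s ω - B s' ω) * (B t ω - B t' ω) ∂P =
      H * (2 * H - 1) *
        ∫ z : ℝ × ℝ, (step s z.1 - step s' z.1) * (step t z.2 - step t' z.2) * covKernel H z := by
  have hi : ∀ a b, Integrable (fun ω => B a ω * B b ω) P := fun a b =>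
    (hB.memLp a).integrable_mul (hB.memLp b)
  have hk := integrable_step_mul_step_mul_covKernel hH
  have e1 : ∀ ω, (B s ω - B s' ω) * (B t ω - B t' ω) =
      (B s ω * B t ω - B s' ω * B t ω) - (B s ω * B t' ω - B s' ω * B t' ω) := fun ω => by ring
  have e2 : ∀ z : ℝ × ℝ,
      (step s z.1 - step s' z.1) * (step t z.2 - step t' z.2) * covKernel H z =
      (step s z.1 * step t z.2 * covKernel H z - step s' z.1 * step t z.2 * covKernel H z) -
      (step s z.1 * step t' z.2 * covKernel H z - step s' z.1 * step t' z.2 * covKernel H z) :=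
    fun z => by ring
  simp_rw [e1, e2]
  rw [integral_sub_sub_sub (hi _ _) (hi _ _) (hi _ _) (hi _ _),
    integral_sub_sub_sub (hk _ _) (hk _ _) (hk _ _) (hk _ _)]
  simp_rw [hB.integral_mul hH]
  ring

theorem integrable_step_sub_mul_covKernel {H : ℝ} (hH : 1 / 2 < H) (s s' t t' : ℝ≥0) :
    Integrable fun z : ℝ × ℝ =>
      (step s z.1 - step s' z.1) * (step t z.2 - step t' z.2) * covKernel H z := by
  have hk := integrable_step_mul_step_mul_covKernel hH
  refine (((hk s t).sub (hk s' t)).sub ((hk s t').sub (hk s' t'))).congr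
    (ae_of_all _ fun z => ?_)
  simp only [Pi.sub_apply]
  ring

/-- Expanding the square reduces to pairs of increments, each correlated through the kernel. The
Riemann sum against $B$ is thereby replaced by the same sum against the path `s ↦ step s u`, which
is a step-function approximation of `f` at `u`. -/
theorem IsFractionalBrownianMotion.integral_leftSum_sq {P : Measure Ω} {H : ℝ} (hH : 1 / 2 < H)
    {B : ℝ≥0 → Ω → ℝ} (hB : IsFractionalBrownianMotion P H B) (f : ℝ≥0 → ℝ) (t : ℝ≥0) (m : ℕ) :
    ∫ ω, leftSum f (fun s => B s ω) t m ^ 2 ∂P =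
      H * (2 * H - 1) * ∫ z : ℝ × ℝ, leftSum f (fun s => step s z.1) t m *
        leftSum f (fun s => step s z.2) t m * covKernel H z := by
  simp only [leftSum, sq]
  simp_rw [Finset.sum_mul_sum, Finset.sum_mul]
  have hi : ∀ a b c d : ℝ≥0, Integrable (fun ω => (B a ω - B b ω) * (B c ω - B d ω)) P :=
    fun a b c d => ((hB.memLp a).sub (hB.memLp b)).integrable_mul ((hB.memLp c).sub (hB.memLp d))
  have e1 : ∀ (a b x y : ℝ), a * x * (b * y) = a * b * (x * y) := fun a b x y => by ring
  have e2 : ∀ (a b x y k : ℝ), a * x * (b * y) * k = a * b * (x * y * k) :=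
    fun a b x y k => by ring
  simp_rw [e2, e1]
  rw [integral_finsetSum _ fun i _ => integrable_finsetSum _ fun j _ => (hi _ _ _ _).const_mul _,
    integral_finsetSum _ fun i _ => integrable_finsetSum _ fun j _ =>
      (integrable_step_sub_mul_covKernel hH _ _ _ _).const_mul _, Finset.mul_sum]
  refine Finset.sum_congr rfl fun i _ => ?_
  rw [integral_finsetSum _ fun j _ => (hi _ _ _ _).const_mul _,
    integral_finsetSum _ fun j _ => (integrable_step_sub_mul_covKernel hH _ _ _ _).const_mul _,
    Finset.mul_sum]
  refine Finset.sum_congr rfl fun j _ => ?_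
  rw [integral_const_mul, integral_const_mul, hB.integral_increment_mul hH]
  ring

/-! ### Gaussian laws of Riemann sums and of their limits -/

theorem IsFractionalBrownianMotion.hasGaussianLaw_leftSum {P : Measure Ω} {H : ℝ}
    {B : ℝ≥0 → Ω → ℝ} (hB : IsFractionalBrownianMotion P H B) (f : ℝ≥0 → ℝ) (t : ℝ≥0) (m : ℕ) :
    HasGaussianLaw (fun ω => leftSum f (fun s => B s ω) t m) P := by
  classical
  have hY : IsGaussianProcess (fun (k : ℕ) ω => f (k * t / m) *
      (B (((k + 1 : ℕ) : ℝ≥0) * t / m) ω - B (k * t / m) ω)) P := by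
    refine hB.gaussian.of_isGaussianProcess fun k =>
      ⟨{((k + 1 : ℕ) : ℝ≥0) * t / m, k * t / m},
        { toFun := fun x => f (k * t / m) * (x ⟨((k + 1 : ℕ) : ℝ≥0) * t / m, by simp⟩ -
            x ⟨k * t / m, by simp⟩)
          map_add' := fun x y => by simp; ring
          map_smul' := fun c x => by simp; ring
          cont := by fun_prop }, fun ω => rfl⟩
  exact hY.hasGaussianLaw_fun_sum

theorem IsFractionalBrownianMotion.integral_leftSum {P : Measure Ω} {H : ℝ}
    {B : ℝ≥0 → Ω → ℝ} (hB : IsFractionalBrownianMotion P H B) (f : ℝ≥0 → ℝ) (t : ℝ≥0) (m : ℕ) :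
    ∫ ω, leftSum f (fun s => B s ω) t m ∂P = 0 := by
  have hi : ∀ s, Integrable (B s) P := fun s => (hB.gaussian.hasGaussianLaw_eval s).integrable
  have hd : ∀ s s', Integrable (fun ω => B s ω - B s' ω) P := fun s s' => (hi s).sub (hi s')
  simp only [leftSum]
  rw [integral_finsetSum _ fun k _ => (hd _ _).const_mul _]
  refine Finset.sum_eq_zero fun k _ => ?_
  rw [integral_const_mul, integral_sub (hi _) (hi _), hB.mean_zero, hB.mean_zero]
  simp

theorem HasGaussianLaw.map_eq_gaussianReal_zero {P : Measure Ω} {X : Ω → ℝ}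
    (hX : HasGaussianLaw X P) (h0 : ∫ ω, X ω ∂P = 0) :
    P.map X = gaussianReal 0 (∫ ω, X ω ^ 2 ∂P).toNNReal := by
  rw [hX.map_eq_gaussianReal, h0, variance_of_integral_eq_zero hX.aemeasurable h0]

/-- Characteristic functions converge in two ways: by bounded convergence along the almost sure
limit, and by continuity of the Gaussian formula in the variance. -/
theorem map_eq_gaussianReal_of_tendsto {P : Measure Ω} [IsProbabilityMeasure P] {X : ℕ → Ω → ℝ}
    {Y : Ω → ℝ} {v : ℕ → ℝ≥0} {w : ℝ≥0} (hX : ∀ m, AEMeasurable (X m) P)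
    (hlaw : ∀ m, P.map (X m) = gaussianReal 0 (v m))
    (hlim : ∀ᵐ ω ∂P, Tendsto (fun m => X m ω) atTop (𝓝 (Y ω)))
    (hv : Tendsto (fun m => (v m : ℝ)) atTop (𝓝 w)) : P.map Y = gaussianReal 0 w := by
  have hY : AEMeasurable Y P := aemeasurable_of_tendsto_metrizable_ae _ hX hlim
  have := Measure.isProbabilityMeasure_map hY
  refine Measure.ext_of_charFun (funext fun r => ?_)
  have hcf : ∀ Z : Ω → ℝ, AEMeasurable Z P →
      charFun (P.map Z) r = ∫ ω, Complex.exp (r * Z ω * Complex.I) ∂P := by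
    intro Z hZ
    rw [charFun_apply_real, integral_map hZ (by fun_prop)]
  have h1 : Tendsto (fun m => charFun (P.map (X m)) r) atTop (𝓝 (charFun (P.map Y) r)) := by
    rw [hcf Y hY]
    simp_rw [hcf _ (hX _)]
    refine tendsto_integral_of_dominated_convergence (fun _ => 1) (fun m => ?_)
      (integrable_const _) (fun m => ae_of_all _ fun ω => ?_) ?_
    · have := (hX m).complex_ofReal
      exact AEMeasurable.aestronglyMeasurable (by fun_prop)
    · rw [← Complex.ofReal_mul, Complex.norm_exp_ofReal_mul_I]
    · filter_upwards [hlim] with ω hω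
      have hc : Continuous fun x : ℝ => Complex.exp (r * x * Complex.I) := by fun_prop
      exact (hc.tendsto _).comp hω
  have h2 : Tendsto (fun m => charFun (P.map (X m)) r) atTop
      (𝓝 (charFun (gaussianReal 0 w) r)) := by
    simp_rw [hlaw, charFun_gaussianReal]
    have hc : Continuous fun x : ℝ =>
        Complex.exp (r * (0 : ℝ) * Complex.I - x * r ^ 2 / 2) := by fun_prop
    exact (hc.tendsto _).comp hv
  exact tendsto_nhds_unique h1 h2

end

section

/-! ### Riemann sums of step functions -/

theorem step_of_le {s : ℝ≥0} {u : ℝ} (hu : 0 < u) (h : u ≤ s) : step s u = 1 :=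
  indicator_of_mem (show u ∈ Ioc (0 : ℝ) s from ⟨hu, h⟩) _

theorem step_of_lt {s : ℝ≥0} {u : ℝ} (h : (s : ℝ) < u) : step s u = 0 :=
  indicator_of_notMem (fun h' => (h'.2.trans_lt h).false) _

theorem mul_div_le_mul_div {j k : ℕ} (h : j ≤ k) (t : ℝ≥0) (m : ℕ) :
    (j : ℝ≥0) * t / m ≤ k * t / m := by
  gcongr

theorem leftSum_step_of_notMem {t : ℝ≥0} {u : ℝ} (hu : u ∉ Ioc (0 : ℝ) t) {m : ℕ} (hm : 0 < m)
    (f : ℝ≥0 → ℝ) : leftSum f (fun s => step s u) t m = 0 := by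
  have hz : ∀ k ≤ m, step (k * t / m) u = 0 := by
    intro k hk
    refine indicator_of_notMem (fun h => hu ⟨h.1, h.2.trans ?_⟩) _
    have h1 := mul_div_le_mul_div hk t m
    rw [mul_div_cancel_left₀ t (by positivity)] at h1
    exact_mod_cast h1
  refine Finset.sum_eq_zero fun k hk => ?_
  have hk' := Finset.mem_range.1 hk
  simp only [hz k hk'.le, hz (k + 1) hk', sub_zero, mul_zero]

/-- Only the cell containing `u` sees the jump of `s ↦ step s u`, so the sum collapses to `f` at the
left end `q` of that cell, independently of `f`. -/
theorem exists_leftSum_step_eq {t : ℝ≥0} {u : ℝ} (hu : u ∈ Ioc (0 : ℝ) t) {m : ℕ} (hm : 0 < m) :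
    ∃ q : ℝ≥0, q ≤ t ∧ |(q : ℝ) - u| ≤ t / m ∧
      ∀ f : ℝ≥0 → ℝ, leftSum f (fun s => step s u) t m = f q := by
  classical
  have hm0 : (0 : ℝ) < m := by exact_mod_cast hm
  have hex : ∃ j : ℕ, u ≤ ((j * t / m : ℝ≥0) : ℝ) := by
    refine ⟨m, ?_⟩
    rw [mul_div_cancel_left₀ t (by positivity)]
    exact hu.2
  have hspec := Nat.find_spec hex
  have hmin : ∀ j < Nat.find hex, ((j * t / m : ℝ≥0) : ℝ) < u :=
    fun j hj => not_le.1 (Nat.find_min hex hj)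
  have hle : Nat.find hex ≤ m := by
    refine Nat.find_min' hex ?_
    rw [mul_div_cancel_left₀ t (by positivity)]
    exact hu.2
  obtain ⟨k, hk⟩ : ∃ k, Nat.find hex = k + 1 := by
    refine Nat.exists_eq_succ_of_ne_zero fun h0 => ?_
    rw [h0] at hspec
    simp only [Nat.cast_zero, zero_mul, zero_div, NNReal.coe_zero] at hspec
    exact (hspec.trans_lt hu.1).false
  rw [hk] at hspec hmin hle
  have hkt : (k * t / m : ℝ≥0) ≤ t := by
    have h1 := mul_div_le_mul_div (show k ≤ m by omega) t m
    rwa [mul_div_cancel_left₀ t (by positivity)] at h1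
  refine ⟨k * t / m, hkt, ?_, fun f => ?_⟩
  · have h1 := hmin k (by omega)
    rw [abs_sub_comm, abs_of_nonneg (by linarith)]
    push_cast at hspec ⊢
    rw [add_mul, add_div, one_mul] at hspec
    linarith
  · rw [leftSum, Finset.sum_eq_single k]
    · rw [step_of_le hu.1 hspec, step_of_lt (hmin k (by omega)), sub_zero, mul_one]
    · intro j _ hj
      rcases lt_or_gt_of_ne hj with h | h
      · rw [step_of_lt (hmin (j + 1) (by omega)), step_of_lt (hmin j (by omega)), sub_zero,
          mul_zero]
      · have h1 : u ≤ ((j * t / m : ℝ≥0) : ℝ) :=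
          hspec.trans (by exact_mod_cast mul_div_le_mul_div (show k + 1 ≤ j by omega) t m)
        have h2 : u ≤ ((((j + 1 : ℕ) : ℝ≥0) * t / m : ℝ≥0) : ℝ) :=
          h1.trans (by exact_mod_cast mul_div_le_mul_div (show j ≤ j + 1 by omega) t m)
        rw [step_of_le hu.1 h1, step_of_le hu.1 h2, sub_self, mul_zero]
    · intro h
      exact absurd (Finset.mem_range.2 (by omega)) h

theorem tendsto_leftSum_step {F : ℝ → ℝ} (hF : Continuous F) {t : ℝ≥0} {u : ℝ}
    (hu : u ∈ Ioc (0 : ℝ) t) :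
    Tendsto (fun m => leftSum (fun s => F s) (fun s => step s u) t (m + 1)) atTop
      (𝓝 (F u)) := by
  choose q _ hq2 hq3 using fun m : ℕ => exists_leftSum_step_eq hu (Nat.succ_pos m)
  have hlim : Tendsto (fun m => (q m : ℝ)) atTop (𝓝 u) := by
    rw [tendsto_iff_dist_tendsto_zero]
    refine squeeze_zero (fun _ => dist_nonneg) (fun m => (Real.dist_eq _ _).le.trans (hq2 m)) ?_
    have := (tendsto_const_div_atTop_nhds_zero_nat (t : ℝ)).comp (tendsto_add_atTop_nat 1)
    exact this
  refine ((hF.tendsto u).comp hlim).congr fun m => ?_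
  exact (hq3 m fun s => F s).symm

theorem measurable_leftSum_step (f : ℝ≥0 → ℝ) (t : ℝ≥0) (m : ℕ) :
    Measurable fun u => leftSum f (fun s => step s u) t m := by
  unfold leftSum
  fun_prop

/-! ### The variance of the fractional Ornstein–Uhlenbeck process -/

/-- `V_{2,H}(t) = H (2H - 1) ∫∫_{(0, t]²} |x - y|^{2H-2} e^{-(x + y)/θ} dx dy`. -/
def fOUVariance (H θ : ℝ) (t : ℝ) : ℝ :=
  H * (2 * H - 1) * ∫ z in Ioc (0 : ℝ) t ×ˢ Ioc (0 : ℝ) t, expKernel (2 * H - 2) (1 / θ) z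

theorem fOUVariance_nonneg {H : ℝ} (hH : 1 / 2 < H) (θ t : ℝ) : 0 ≤ fOUVariance H θ t :=
  mul_nonneg (mul_nonneg (by linarith) (by linarith))
    (integral_nonneg fun z => expKernel_nonneg _ _ z)

theorem integrableOn_expKernel_square {H θ : ℝ} (hH : 1 / 2 < H) (hθ : 0 < θ) (t : ℝ) :
    IntegrableOn (expKernel (2 * H - 2) (1 / θ)) (Ioc (0 : ℝ) t ×ˢ Ioc (0 : ℝ) t) :=
  (integrableOn_expKernel (by linarith) (by positivity)).mono_set
    (prod_mono (fun _ hx => hx.1) fun _ hx => hx.1)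

theorem fOUVariance_mono {H θ : ℝ} (hH : 1 / 2 < H) (hθ : 0 < θ) :
    Monotone (fOUVariance H θ) := by
  intro s t hst
  refine mul_le_mul_of_nonneg_left ?_ (mul_nonneg (by linarith) (by linarith))
  exact setIntegral_mono_set (integrableOn_expKernel_square hH hθ t)
    (ae_of_all _ fun z => expKernel_nonneg _ _ z)
    (prod_mono (Ioc_subset_Ioc_right hst) (Ioc_subset_Ioc_right hst)).eventuallyLE

theorem tendsto_fOUVariance {H θ : ℝ} (hH : 1 / 2 < H) (hθ : 0 < θ) :
    Tendsto (fOUVariance H θ) atTop (𝓝 (varianceAtInfinity H θ)) := by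
  have hc : AECover ((volume : Measure (ℝ × ℝ)).restrict (Ioi (0 : ℝ) ×ˢ Ioi (0 : ℝ))) atTop
      fun t : ℝ => Ioc (0 : ℝ) t ×ˢ Ioc (0 : ℝ) t := by
    refine ⟨(ae_restrict_mem (measurableSet_Ioi.prod measurableSet_Ioi)).mono fun z hz => ?_,
      fun t => measurableSet_Ioc.prod measurableSet_Ioc⟩
    filter_upwards [eventually_ge_atTop z.1, eventually_ge_atTop z.2] with t h1 h2
    exact ⟨⟨hz.1, h1⟩, ⟨hz.2, h2⟩⟩
  have h := (hc.integral_tendsto_of_countably_generated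
    (integrableOn_expKernel (a := 2 * H - 2) (by linarith)
      (show 0 < 1 / θ by positivity))).const_mul (H * (2 * H - 1))
  rw [integral_expKernel (by linarith) (by positivity), one_div_one_div,
    show 2 * H - 2 + 2 = 2 * H by ring, show 2 * H - 2 + 1 = 2 * H - 1 by ring,
    ← varianceAtInfinity_eq hH] at h
  refine h.congr fun t => ?_
  rw [fOUVariance, Measure.restrict_restrict (measurableSet_Ioc.prod measurableSet_Ioc),
    inter_eq_left.2 (prod_mono (fun _ hx => hx.1) fun _ hx => hx.1)]

/-- This reflection moves all dependence on $t$ from the integrand of the variance to the domain,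
which is what makes monotonicity visible. -/
theorem setIntegral_square_comp_sub (g : ℝ × ℝ → ℝ) (t : ℝ) :
    ∫ z in Ioc (0 : ℝ) t ×ˢ Ioc (0 : ℝ) t, g (t - z.1, t - z.2) =
      ∫ z in Ioc (0 : ℝ) t ×ˢ Ioc (0 : ℝ) t, g z := by
  -- The half-open square is not invariant under the reflection; the open one is, and differs from
  -- it by a null set.
  have hae : (Ioc (0 : ℝ) t ×ˢ Ioc (0 : ℝ) t : Set (ℝ × ℝ)) =ᵐ[volume]
      (Ioo (0 : ℝ) t ×ˢ Ioo (0 : ℝ) t : Set (ℝ × ℝ)) := by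
    rw [Measure.volume_eq_prod]
    exact Measure.set_prod_ae_eq Ioo_ae_eq_Ioc.symm Ioo_ae_eq_Ioc.symm
  have hm : MeasurableSet (Ioo (0 : ℝ) t ×ˢ Ioo (0 : ℝ) t) :=
    measurableSet_Ioo.prod measurableSet_Ioo
  rw [setIntegral_congr_set hae, setIntegral_congr_set hae, ← integral_indicator hm,
    ← integral_indicator hm, ← integral_sub_left_eq_self _ volume ((t, t) : ℝ × ℝ)]
  refine integral_congr_ae (ae_of_all _ fun z => ?_)
  by_cases hz : z ∈ Ioo (0 : ℝ) t ×ˢ Ioo (0 : ℝ) t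
  · have hz' : (t, t) - z ∈ Ioo (0 : ℝ) t ×ˢ Ioo (0 : ℝ) t := by
      obtain ⟨⟨h1, h2⟩, h3, h4⟩ := hz
      exact ⟨⟨by simpa using h2, by simpa using h1⟩, by simpa using h4, by simpa using h3⟩
    simp only [indicator_of_mem hz, indicator_of_mem hz', Prod.fst_sub, Prod.snd_sub,
      sub_sub_cancel]
  · have hz' : (t, t) - z ∉ Ioo (0 : ℝ) t ×ˢ Ioo (0 : ℝ) t := by
      rintro ⟨⟨h1, h2⟩, h3, h4⟩
      exact hz ⟨⟨by simpa using h2, by simpa using h1⟩, by simpa using h4, by simpa using h3⟩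
    simp only [indicator_of_notMem hz, indicator_of_notMem hz']

/-- Dominated convergence with majorant $e^{2t/\theta}|u-v|^{2H-2}$ on the square. The index `m + 1`
avoids the degenerate partition with no cells. -/
theorem tendsto_integral_leftSum_step {H θ : ℝ} (hH : 1 / 2 < H) (hθ : 0 < θ) (t : ℝ≥0) :
    Tendsto (fun m => ∫ z : ℝ × ℝ,
        leftSum (fun s => Real.exp (s / θ)) (fun s => step s z.1) t (m + 1) *
        leftSum (fun s => Real.exp (s / θ)) (fun s => step s z.2) t (m + 1) * covKernel H z)
      atTop (𝓝 (∫ z in Ioc (0 : ℝ) t ×ˢ Ioc (0 : ℝ) t,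
        Real.exp (z.1 / θ) * Real.exp (z.2 / θ) * covKernel H z)) := by
  have hm : MeasurableSet (Ioc (0 : ℝ) t ×ˢ Ioc (0 : ℝ) t) :=
    measurableSet_Ioc.prod measurableSet_Ioc
  rw [← integral_indicator hm]
  refine tendsto_integral_of_dominated_convergence
    ((Ioc (0 : ℝ) t ×ˢ Ioc (0 : ℝ) t).indicator
      fun z => Real.exp (t / θ) * Real.exp (t / θ) * covKernel H z) (fun m => ?_) ?_ (fun m => ?_) ?_
  · have h := measurable_leftSum_step (fun s => Real.exp (s / θ)) t (m + 1)
    exact (((h.comp measurable_fst).mul (h.comp measurable_snd)).mul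
      (measurable_covKernel H)).aestronglyMeasurable
  · rw [integrable_indicator_iff hm]
    exact (integrableOn_covKernel hH t t).const_mul _
  · refine ae_of_all _ fun z => ?_
    by_cases h1 : z.1 ∈ Ioc (0 : ℝ) t
    · by_cases h2 : z.2 ∈ Ioc (0 : ℝ) t
      · rw [indicator_of_mem (mk_mem_prod h1 h2)]
        obtain ⟨q1, hq1, -, hf1⟩ := exists_leftSum_step_eq h1 (Nat.succ_pos m)
        obtain ⟨q2, hq2, -, hf2⟩ := exists_leftSum_step_eq h2 (Nat.succ_pos m)
        rw [hf1, hf2, Real.norm_eq_abs, abs_of_nonneg (mul_nonneg (by positivity)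
          (covKernel_nonneg H z))]
        have := covKernel_nonneg H z
        gcongr
      · rw [leftSum_step_of_notMem h2 (Nat.succ_pos m),
          indicator_of_notMem (fun h => h2 h.2)]
        simp
    · rw [leftSum_step_of_notMem h1 (Nat.succ_pos m), indicator_of_notMem (fun h => h1 h.1)]
      simp
  · refine ae_of_all _ fun z => ?_
    by_cases h1 : z.1 ∈ Ioc (0 : ℝ) t
    · by_cases h2 : z.2 ∈ Ioc (0 : ℝ) t
      · rw [indicator_of_mem (mk_mem_prod h1 h2)]
        have hc : Continuous fun s : ℝ => Real.exp (s / θ) := by fun_prop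
        exact ((tendsto_leftSum_step hc h1).mul (tendsto_leftSum_step hc h2)).mul_const _
      · simp_rw [leftSum_step_of_notMem h2 (Nat.succ_pos _)]
        rw [indicator_of_notMem (fun h => h2 h.2)]
        simp
    · simp_rw [leftSum_step_of_notMem h1 (Nat.succ_pos _)]
      rw [indicator_of_notMem (fun h => h1 h.1)]
      simp

variable {Ω : Type*} [MeasurableSpace Ω] {P : Measure Ω} {H θ : ℝ} {B : ℝ≥0 → Ω → ℝ}

theorem map_fOU [IsProbabilityMeasure P] (hH : 1 / 2 < H) (hθ : 0 < θ)
    (hB : IsFractionalBrownianMotion P H B) (t : ℝ≥0) :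
    P.map (fOU θ B t) = gaussianReal 0 (fOUVariance H θ t).toNNReal := by
  set c := Real.exp (-(t : ℝ) / θ) with hc
  set S : ℕ → Ω → ℝ := fun m ω =>
    c * leftSum (fun s => Real.exp ((s : ℝ) / θ)) (fun s => B s ω) t (m + 1) with hS
  have hlaw : ∀ m, HasGaussianLaw (S m) P := fun m =>
    (hB.hasGaussianLaw_leftSum _ t (m + 1)).fun_smul c
  have hmean : ∀ m, ∫ ω, S m ω ∂P = 0 := by
    intro m
    rw [hS, integral_const_mul, hB.integral_leftSum, mul_zero]
  have hvar : ∀ m, ∫ ω, S m ω ^ 2 ∂P = c ^ 2 * (H * (2 * H - 1) * ∫ z : ℝ × ℝ,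
        leftSum (fun s => Real.exp (s / θ)) (fun s => step s z.1) t (m + 1) *
        leftSum (fun s => Real.exp (s / θ)) (fun s => step s z.2) t (m + 1) *
          covKernel H z) := by
    intro m
    simp only [hS, mul_pow]
    rw [integral_const_mul, hB.integral_leftSum_sq hH]
  have hlim : c ^ 2 * (H * (2 * H - 1) * ∫ z in Ioc (0 : ℝ) t ×ˢ Ioc (0 : ℝ) t,
        Real.exp (z.1 / θ) * Real.exp (z.2 / θ) * covKernel H z) = fOUVariance H θ t := by
    rw [fOUVariance, ← setIntegral_square_comp_sub, mul_left_comm, ← integral_const_mul]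
    congr 1
    refine integral_congr_ae (ae_of_all _ fun z => ?_)
    simp only [expKernel, covKernel]
    rw [sub_sub_sub_cancel_left, abs_sub_comm, ← Real.exp_add, hc, ← Real.exp_nat_mul,
      ← mul_assoc, ← Real.exp_add, mul_comm]
    congr 2
    push_cast
    ring
  refine map_eq_gaussianReal_of_tendsto (fun m => (hlaw m).aemeasurable)
    (fun m => HasGaussianLaw.map_eq_gaussianReal_zero (hlaw m) (hmean m)) ?_ ?_
  · filter_upwards [hB.continuous_paths] with ω hω
    exact (tendsto_leftSum_fOU hω t).comp (tendsto_add_atTop_nat 1)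
  · rw [Real.coe_toNNReal _ (fOUVariance_nonneg hH θ t), ← hlim]
    simp_rw [Real.coe_toNNReal _ (integral_nonneg fun ω => sq_nonneg _), hvar]
    exact ((tendsto_integral_leftSum_step hH hθ t).const_mul _).const_mul _

theorem aemeasurable_fOU (hB : IsFractionalBrownianMotion P H B) (t : ℝ≥0) :
    AEMeasurable (fOU θ B t) P := by
  refine aemeasurable_of_tendsto_metrizable_ae atTop
    (fun m => ((hB.hasGaussianLaw_leftSum (fun s => Real.exp (s / θ)) t m).fun_smul
      (Real.exp (-(t : ℝ) / θ))).aemeasurable)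
    ?_
  filter_upwards [hB.continuous_paths] with ω hω
  exact tendsto_leftSum_fOU hω t

theorem integrable_fOU_pow [IsProbabilityMeasure P] (hH : 1 / 2 < H) (hθ : 0 < θ)
    (hB : IsFractionalBrownianMotion P H B) (t : ℝ≥0) (m : ℕ) :
    Integrable (fun ω => |fOU θ B t ω| ^ m) P := by
  have hU := aemeasurable_fOU (θ := θ) hB t
  have h : Integrable (fun x : ℝ => |x| ^ m) (P.map (fOU θ B t)) := by
    rw [map_fOU hH hθ hB t]
    have := (memLp_id_gaussianReal (μ := 0) (v := (fOUVariance H θ t).toNNReal)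
      m).integrable_norm_pow'
    simpa using this
  exact h.comp_aemeasurable hU

/-- The `2n`-th moment of the standard Gaussian law. -/
def gaussianMoment (n : ℕ) : ℝ := 2 ^ n * Real.Gamma ((2 * (n : ℝ) + 1) / 2) / √Real.pi

theorem gaussianMoment_nonneg (n : ℕ) : 0 ≤ gaussianMoment n := by
  have : 0 < Real.Gamma ((2 * (n : ℝ) + 1) / 2) := Real.Gamma_pos_of_pos (by positivity)
  unfold gaussianMoment
  positivity

theorem absMoment_fOU [IsProbabilityMeasure P] (hH : 1 / 2 < H) (hθ : 0 < θ)
    (hB : IsFractionalBrownianMotion P H B) (n : ℕ) (t : ℝ≥0) :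
    absMoment P (fOU θ B) (2 * n) t = gaussianMoment n * fOUVariance H θ t ^ n := by
  have h := integral_even_pow_gaussianReal n (fOUVariance H θ t).toNNReal
  rw [← map_fOU hH hθ hB t, integral_map (aemeasurable_fOU hB t) (by fun_prop),
    Real.coe_toNNReal _ (fOUVariance_nonneg hH θ t)] at h
  exact h

theorem tendsto_absMoment_fOU [IsProbabilityMeasure P] (hH : 1 / 2 < H) (hθ : 0 < θ)
    (hB : IsFractionalBrownianMotion P H B) (n : ℕ) :
    Tendsto (absMoment P (fOU θ B) (2 * n)) atTop (𝓝 (momentAtInfinity H θ n)) := by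
  have h := (((tendsto_fOUVariance hH hθ).comp
    (NNReal.tendsto_coe_atTop.2 tendsto_id)).pow n).const_mul (gaussianMoment n)
  exact h.congr fun t => (absMoment_fOU hH hθ hB n t).symm

theorem monotone_absMoment_fOU [IsProbabilityMeasure P] (hH : 1 / 2 < H) (hθ : 0 < θ)
    (hB : IsFractionalBrownianMotion P H B) (n : ℕ) :
    Monotone (absMoment P (fOU θ B) (2 * n)) := by
  intro s t hst
  rw [absMoment_fOU hH hθ hB, absMoment_fOU hH hθ hB]
  exact mul_le_mul_of_nonneg_left (pow_le_pow_left₀ (fOUVariance_nonneg hH θ s)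
    (fOUVariance_mono hH hθ hst) n) (gaussianMoment_nonneg n)

/-- The characteristic function at $1$ equals $e^{-\mathrm{Var}/2}$ and is continuous in $t$ by
bounded convergence along continuous paths; taking logarithms gives the variance. -/
theorem continuous_fOUVariance [IsProbabilityMeasure P] (hH : 1 / 2 < H) (hθ : 0 < θ)
    (hB : IsFractionalBrownianMotion P H B) : Continuous fun t : ℝ≥0 => fOUVariance H θ t := by
  have hchar : ∀ t : ℝ≥0, ∫ ω, Complex.exp (fOU θ B t ω * Complex.I) ∂P =
      Real.exp (-(fOUVariance H θ t / 2)) := by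
    intro t
    have h := charFun_gaussianReal (μ := 0) (v := (fOUVariance H θ t).toNNReal) 1
    rw [← map_fOU hH hθ hB t, charFun_apply_real,
      integral_map (aemeasurable_fOU hB t) (by fun_prop),
      Real.coe_toNNReal _ (fOUVariance_nonneg hH θ t)] at h
    simpa using h
  have hcont : Continuous fun t : ℝ≥0 => ∫ ω, Complex.exp (fOU θ B t ω * Complex.I) ∂P := by
    refine continuous_of_dominated (bound := fun _ => 1) (fun t => ?_) (fun t => ?_)
      (integrable_const _) ?_
    · have := (aemeasurable_fOU (θ := θ) hB t).complex_ofReal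
      exact AEMeasurable.aestronglyMeasurable (by fun_prop)
    · exact ae_of_all _ fun ω => (Complex.norm_exp_ofReal_mul_I _).le
    · filter_upwards [hB.continuous_paths] with ω hω
      have := continuous_fOU (θ := θ) hω
      fun_prop
  simp_rw [hchar] at hcont
  have hre : Continuous fun t : ℝ≥0 => Real.exp (-(fOUVariance H θ t / 2)) := by
    have := Complex.continuous_re.comp hcont
    exact this
  have hlog : Continuous fun t : ℝ≥0 => Real.log (Real.exp (-(fOUVariance H θ t / 2))) :=
    hre.log fun t => (Real.exp_pos _).ne'
  simp_rw [Real.log_exp] at hlog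
  refine (hlog.const_mul (-2)).congr fun t => ?_
  ring

theorem continuous_absMoment_fOU [IsProbabilityMeasure P] (hH : 1 / 2 < H) (hθ : 0 < θ)
    (hB : IsFractionalBrownianMotion P H B) (n : ℕ) :
    Continuous (absMoment P (fOU θ B) (2 * n)) := by
  have := continuous_fOUVariance hH hθ hB
  have h : Continuous fun t : ℝ≥0 => gaussianMoment n * fOUVariance H θ t ^ n := by fun_prop
  exact h.congr fun t => (absMoment_fOU hH hθ hB n t).symm

theorem absMoment_fOU_le [IsProbabilityMeasure P] (hH : 1 / 2 < H) (hθ : 0 < θ)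
    (hB : IsFractionalBrownianMotion P H B) (n : ℕ) (t : ℝ≥0) :
    absMoment P (fOU θ B) (2 * n) t ≤ momentAtInfinity H θ n :=
  (monotone_absMoment_fOU hH hθ hB n).ge_of_tendsto (tendsto_absMoment_fOU hH hθ hB n) t

end

section

/-! ### The Laplace exponent -/

theorem one_sub_exp_nonneg {l x : ℝ} (hl : 0 < l) (hx : 0 < x) : 0 ≤ 1 - Real.exp (-l * x) := by
  have : Real.exp (-l * x) ≤ 1 := Real.exp_le_one_iff.2 (by nlinarith)
  linarith

theorem IsSubordinatorLevyMeasure.integrableOn {ν : Measure ℝ} (hν : IsSubordinatorLevyMeasure ν)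
    {l : ℝ} (hl : 0 < l) : IntegrableOn (fun x => 1 - Real.exp (-l * x)) (Ioi 0) ν := by
  have h1 : IntegrableOn (fun x : ℝ => min 1 x) (Ioi 0) ν :=
    (lintegral_ofReal_ne_top_iff_integrable (by fun_prop)
      ((ae_restrict_mem measurableSet_Ioi).mono fun x hx =>
        le_min zero_le_one (le_of_lt hx))).1 hν.integrable.ne
  refine (h1.const_mul (max 1 l)).mono' (by fun_prop) ?_
  refine (ae_restrict_mem measurableSet_Ioi).mono fun x hx => ?_
  have hx' : 0 < x := hx
  rw [Real.norm_eq_abs, abs_of_nonneg (one_sub_exp_nonneg hl hx)]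
  have h2 : 1 - Real.exp (-l * x) ≤ 1 := by linarith [Real.exp_pos (-l * x)]
  have h3 : 1 - Real.exp (-l * x) ≤ l * x := by linarith [Real.add_one_le_exp (-l * x)]
  rcases le_total 1 x with h | h
  · rw [min_eq_left h, mul_one]
    exact h2.trans (le_max_left _ _)
  · rw [min_eq_right h]
    exact h3.trans (mul_le_mul_of_nonneg_right (le_max_right _ _) hx'.le)

/-- Monotone convergence: $1-e^{-(k+1)x}$ increases to $1$, so the exponents increase to
$\nu(0,\infty)$. Infinite activity enters here. -/
theorem IsSubordinatorLevyMeasure.tendsto_laplaceExponent {ν : Measure ℝ}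
    (hν : IsSubordinatorLevyMeasure ν) (hinf : ν (Ioi 0) = ∞) :
    Tendsto (fun k : ℕ => laplaceExponent ν (k + 1)) atTop atTop := by
  rw [← ENNReal.tendsto_ofReal_nhds_top]
  have hk : ∀ k : ℕ, (0 : ℝ) < k + 1 := fun k => by positivity
  have h1 : ∀ k : ℕ, ENNReal.ofReal (laplaceExponent ν (k + 1)) =
      ∫⁻ x in Ioi (0 : ℝ), ENNReal.ofReal (1 - Real.exp (-(k + 1 : ℝ) * x)) ∂ν := fun k =>
    ofReal_integral_eq_lintegral_ofReal (hν.integrableOn (hk k))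
      ((ae_restrict_mem measurableSet_Ioi).mono fun x hx => one_sub_exp_nonneg (hk k) hx)
  simp_rw [h1]
  have h2 : ∫⁻ _ in Ioi (0 : ℝ), (1 : ℝ≥0∞) ∂ν = ∞ := by simp [hinf]
  rw [← h2]
  refine lintegral_tendsto_of_tendsto_of_monotone (fun k => by fun_prop) ?_ ?_
  · refine (ae_restrict_mem measurableSet_Ioi).mono fun x hx j k hjk => ?_
    have hx' : 0 < x := hx
    have : (j : ℝ) ≤ k := by exact_mod_cast hjk
    refine ENNReal.ofReal_le_ofReal (sub_le_sub_left (Real.exp_le_exp.2 ?_) _)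
    nlinarith
  · refine (ae_restrict_mem measurableSet_Ioi).mono fun x hx => ?_
    have hx' : 0 < x := hx
    have h3 : Tendsto (fun k : ℕ => 1 - Real.exp (-(k + 1 : ℝ) * x)) atTop (𝓝 (1 - 0)) := by
      refine tendsto_const_nhds.sub (Real.tendsto_exp_atBot.comp ?_)
      have h4 : Tendsto (fun k : ℕ => (k + 1 : ℝ) * x) atTop atTop :=
        (tendsto_atTop_add_const_right _ 1 tendsto_natCast_atTop_atTop).atTop_mul_const hx'
      refine (tendsto_neg_atTop_atBot.comp h4).congr fun k => ?_
      simp only [Function.comp_apply, neg_mul]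
    have := ENNReal.tendsto_ofReal h3
    simpa using this

/-! ### Paths of the inverse subordinator -/

variable {Ω : Type*} {σ : ℝ≥0 → Ω → ℝ}

theorem inverseSubordinator_le {t y : ℝ≥0} {ω : Ω} (hy : 0 < y) (h : (t : ℝ) < σ y ω) :
    inverseSubordinator σ t ω ≤ y :=
  csInf_le (OrderBot.bddBelow _) ⟨hy, h⟩

theorem nonempty_of_unbounded {ω : Ω} (hm : StrictMono fun y => σ y ω)
    (hu : ∀ a : ℝ, ∃ y, a < σ y ω) (t : ℝ≥0) : {y : ℝ≥0 | 0 < y ∧ (t : ℝ) < σ y ω}.Nonempty := by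
  obtain ⟨y, hy⟩ := hu t
  -- The witness is moved to `y + 1` because the infimum ranges over positive `y` only.
  exact ⟨y + 1, by positivity, hy.trans (hm (by simp))⟩

theorem le_inverseSubordinator {t y : ℝ≥0} {ω : Ω} (hm : StrictMono fun y => σ y ω)
    (hu : ∀ a : ℝ, ∃ y, a < σ y ω) (h : σ y ω ≤ t) : y ≤ inverseSubordinator σ t ω :=
  le_csInf (nonempty_of_unbounded hm hu t) fun _ hz => (hm.lt_iff_lt.1 (h.trans_lt hz.2)).le

theorem monotone_inverseSubordinator {ω : Ω} (hm : StrictMono fun y => σ y ω)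
    (hu : ∀ a : ℝ, ∃ y, a < σ y ω) : Monotone fun t => inverseSubordinator σ t ω := by
  intro s t hst
  refine csInf_le_csInf (OrderBot.bddBelow _) (nonempty_of_unbounded hm hu t) fun y hy => ?_
  exact ⟨hy.1, lt_of_le_of_lt (by exact_mod_cast hst) hy.2⟩

/-- A strictly increasing path has no flat stretches, so its inverse has no jumps. From below, two
points between `a` and $E(t)$ give a strict inequality $\sigma(b)<t$, which survives small changes
of $t$. -/
theorem continuous_inverseSubordinator {ω : Ω} (hm : StrictMono fun y => σ y ω)
    (hu : ∀ a : ℝ, ∃ y, a < σ y ω) : Continuous fun t => inverseSubordinator σ t ω := by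
  have hc : ∀ t : ℝ≥0, Tendsto (fun s : ℝ≥0 => (s : ℝ)) (𝓝 t) (𝓝 (t : ℝ)) := fun t =>
    NNReal.continuous_coe.tendsto t
  refine continuous_iff_continuousAt.2 fun t => tendsto_order.2 ⟨fun a ha => ?_, fun a ha => ?_⟩
  · obtain ⟨b, hab, hb⟩ := exists_between ha
    obtain ⟨c, hbc, hcE⟩ := exists_between hb
    have hct : σ c ω ≤ t := by
      by_contra! h
      exact hcE.not_ge (inverseSubordinator_le (bot_le.trans_lt hbc) h)
    have hbt : σ b ω < t := (hm hbc).trans_le hct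
    filter_upwards [(hc t).eventually (lt_mem_nhds hbt)] with s hs
    exact hab.trans_le (le_inverseSubordinator hm hu hs.le)
  · obtain ⟨y, hy, hya⟩ := exists_lt_of_csInf_lt (nonempty_of_unbounded hm hu t) ha
    filter_upwards [(hc t).eventually (gt_mem_nhds hy.2)] with s hs
    exact (inverseSubordinator_le hy.1 hs).trans_lt hya

theorem tendsto_inverseSubordinator {ω : Ω} (hm : StrictMono fun y => σ y ω)
    (hu : ∀ a : ℝ, ∃ y, a < σ y ω) : Tendsto (fun t => inverseSubordinator σ t ω) atTop atTop := by
  refine tendsto_atTop.2 fun y => ?_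
  filter_upwards [eventually_ge_atTop (σ y ω).toNNReal] with t ht
  exact le_inverseSubordinator hm hu ((Real.le_coe_toNNReal _).trans (by exact_mod_cast ht))

/-! ### Paths of a driftless subordinator with infinite Lévy measure -/

variable [MeasurableSpace Ω] {P : Measure Ω} {ν : Measure ℝ}

theorem IsDriftlessSubordinator.lintegral_exp (hσ : IsDriftlessSubordinator P ν σ) (y : ℝ≥0)
    {l : ℝ} (hl : 0 < l) :
    ∫⁻ ω, ENNReal.ofReal (Real.exp (-l * σ y ω)) ∂P =
      ENNReal.ofReal (Real.exp (-(y : ℝ) * laplaceExponent ν l)) := by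
  have hi : Integrable (fun ω => Real.exp (-l * σ y ω)) P := by
    refine not_imp_comm.1 integral_undef ?_
    rw [hσ.laplace y l hl]
    exact (Real.exp_pos _).ne'
  rw [← hσ.laplace y l hl, ofReal_integral_eq_lintegral_ofReal hi
    (ae_of_all _ fun ω => (Real.exp_pos _).le)]

/-- Markov's inequality for $e^{-\lambda\sigma(y)}$. Taking $a=0$ and $\lambda\to\infty$ yields
positivity; fixing $\lambda$ with $\Psi(\lambda)>0$ and letting $y\to\infty$ yields unboundedness.
-/
theorem IsDriftlessSubordinator.meas_le_le (hσ : IsDriftlessSubordinator P ν σ) (y : ℝ≥0)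
    {l : ℝ} (hl : 0 < l) (a : ℝ) :
    P {ω | σ y ω ≤ a} ≤
      ENNReal.ofReal (Real.exp (l * a) * Real.exp (-(y : ℝ) * laplaceExponent ν l)) := by
  have hm := hσ.aemeasurable y
  have h := mul_meas_ge_le_lintegral₀ (μ := P)
    (f := fun ω => ENNReal.ofReal (Real.exp (-l * σ y ω))) (by fun_prop)
    (ENNReal.ofReal (Real.exp (-l * a)))
  rw [hσ.lintegral_exp y hl] at h
  have hsub : {ω | σ y ω ≤ a} ⊆ {ω | ENNReal.ofReal (Real.exp (-l * a)) ≤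
      ENNReal.ofReal (Real.exp (-l * σ y ω))} := by
    intro ω hω
    have hω' : σ y ω ≤ a := hω
    refine ENNReal.ofReal_le_ofReal (Real.exp_le_exp.2 ?_)
    nlinarith
  calc P {ω | σ y ω ≤ a}
      = ENNReal.ofReal (Real.exp (l * a)) *
          (ENNReal.ofReal (Real.exp (-l * a)) * P {ω | σ y ω ≤ a}) := by
        rw [← mul_assoc, ← ENNReal.ofReal_mul (Real.exp_pos _).le, ← Real.exp_add]
        simp
    _ ≤ _ := by
        rw [ENNReal.ofReal_mul (Real.exp_pos _).le]
        gcongr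
        exact (mul_le_mul_right (measure_mono hsub) _).trans h

theorem IsDriftlessSubordinator.ae_pos (hσ : IsDriftlessSubordinator P ν σ)
    (hν : ν (Ioi 0) = ∞) {y : ℝ≥0} (hy : 0 < y) : ∀ᵐ ω ∂P, 0 < σ y ω := by
  have hlim : Tendsto (fun k : ℕ => ENNReal.ofReal (Real.exp ((k + 1 : ℝ) * 0) *
      Real.exp (-(y : ℝ) * laplaceExponent ν (k + 1)))) atTop (𝓝 (ENNReal.ofReal 0)) := by
    refine ENNReal.tendsto_ofReal ?_
    simp only [mul_zero, Real.exp_zero, one_mul, neg_mul]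
    exact Real.tendsto_exp_neg_atTop_nhds_zero.comp
      ((hσ.levy.tendsto_laplaceExponent hν).const_mul_atTop (by exact_mod_cast hy))
  have h0 : P {ω | σ y ω ≤ 0} ≤ ENNReal.ofReal 0 :=
    ge_of_tendsto' hlim fun k => hσ.meas_le_le y (by positivity) 0
  rw [ENNReal.ofReal_zero, nonpos_iff_eq_zero] at h0
  rw [ae_iff]
  simpa using h0

theorem IsDriftlessSubordinator.ae_unbounded (hσ : IsDriftlessSubordinator P ν σ)
    (hν : ν (Ioi 0) = ∞) : ∀ᵐ ω ∂P, ∀ a : ℝ, ∃ y, a < σ y ω := by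
  obtain ⟨k, hk⟩ := ((hσ.levy.tendsto_laplaceExponent hν).eventually_gt_atTop 0).exists
  have hN : ∀ᵐ ω ∂P, ∀ N : ℕ, ∃ j : ℕ, (N : ℝ) < σ j ω := by
    rw [ae_all_iff]
    intro N
    have hlim : Tendsto (fun j : ℕ => ENNReal.ofReal (Real.exp ((k + 1 : ℝ) * N) *
        Real.exp (-(((j : ℕ) : ℝ≥0) : ℝ) * laplaceExponent ν (k + 1)))) atTop
        (𝓝 (ENNReal.ofReal (Real.exp ((k + 1 : ℝ) * N) * 0))) := by
      refine ENNReal.tendsto_ofReal (Tendsto.const_mul _ ?_)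
      simp only [neg_mul, NNReal.coe_natCast]
      exact Real.tendsto_exp_neg_atTop_nhds_zero.comp
        (tendsto_natCast_atTop_atTop.atTop_mul_const hk)
    have h0 : P {ω | ∀ j : ℕ, σ j ω ≤ N} ≤
        ENNReal.ofReal (Real.exp ((k + 1 : ℝ) * N) * 0) :=
      ge_of_tendsto' hlim fun j =>
        (measure_mono (show {ω | ∀ j : ℕ, σ j ω ≤ N} ⊆ {ω | σ j ω ≤ N} from
          fun ω hω => hω j)).trans (hσ.meas_le_le j (by positivity) N)
    rw [mul_zero, ENNReal.ofReal_zero, nonpos_iff_eq_zero] at h0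
    rw [ae_iff]
    simpa using h0
  filter_upwards [hN] with ω hω a
  obtain ⟨N, hN⟩ := exists_nat_gt a
  obtain ⟨j, hj⟩ := hω N
  exact ⟨j, hN.trans hj⟩

/-- By stationarity each increment between points of a countable dense set is almost surely
positive, and monotone paths carry strictness to all times. -/
theorem IsDriftlessSubordinator.ae_strictMono (hσ : IsDriftlessSubordinator P ν σ)
    (hν : ν (Ioi 0) = ∞) : ∀ᵐ ω ∂P, StrictMono fun y => σ y ω := by
  obtain ⟨D, hDc, hDd⟩ := TopologicalSpace.exists_countable_dense ℝ≥0
  have hinc : ∀ᵐ ω ∂P, ∀ q ∈ D, ∀ r ∈ D, q < r → σ q ω < σ r ω := by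
    rw [ae_ball_iff hDc]
    intro q _
    rw [ae_ball_iff hDc]
    intro r _
    by_cases hqr : q < r
    · have hid := hσ.stationary_increments q (r - q)
      rw [add_tsub_cancel_of_le hqr.le] at hid
      have hpos := hσ.ae_pos hν (tsub_pos_of_lt hqr)
      have := hid.symm.ae_snd (p := fun x => 0 < x) measurableSet_Ioi hpos
      filter_upwards [this] with ω hω _
      exact sub_pos.1 hω
    · exact ae_of_all _ fun ω h => absurd h hqr
  filter_upwards [hinc, hσ.paths] with ω h1 h2 x y hxy
  obtain ⟨q, hq, hxq, hqy⟩ := hDd.exists_between hxy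
  obtain ⟨r, hr, hqr, hry⟩ := hDd.exists_between hqy
  exact (h2.1 hxq.le).trans_lt ((h1 q hq r hr hqr).trans_le (h2.1 hry.le))

/-- On strictly increasing paths the infimum may be taken over a countable dense set. Indices that
fail the condition get the value `⊤`, hence do not affect it. -/
theorem IsDriftlessSubordinator.aemeasurable_inverse (hσ : IsDriftlessSubordinator P ν σ)
    (hν : ν (Ioi 0) = ∞) (t : ℝ≥0) : AEMeasurable (inverseSubordinator σ t) P := by
  classical
  obtain ⟨D, hDc, hDd⟩ := TopologicalSpace.exists_countable_dense ℝ≥0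
  set g : ℝ≥0 → ℝ → ℝ≥0∞ := fun q x => if 0 < q ∧ (t : ℝ) < x then (q : ℝ≥0∞) else ⊤ with hg
  have hgm : ∀ q, Measurable (g q) := fun q =>
    Measurable.ite ((MeasurableSet.const _).inter measurableSet_Ioi) measurable_const
      measurable_const
  have hm : AEMeasurable (fun ω => ⨅ q ∈ D, g q (σ q ω)) P :=
    AEMeasurable.biInf D hDc fun q _ => (hgm q).comp_aemeasurable (hσ.aemeasurable q)
  refine hm.ennreal_toNNReal.congr ?_
  filter_upwards [hσ.ae_strictMono hν, hσ.ae_unbounded hν] with ω h1 h2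
  suffices h : ⨅ q ∈ D, g q (σ q ω) = (inverseSubordinator σ t ω : ℝ≥0∞) by
    rw [h, ENNReal.toNNReal_coe]
  refine le_antisymm (le_of_forall_gt_imp_ge_of_dense fun c hc => ?_) ?_
  · induction c with
    | top => exact le_top
    | coe d =>
      obtain ⟨y, hy, hyd⟩ := exists_lt_of_csInf_lt (nonempty_of_unbounded h1 h2 t)
        (show inverseSubordinator σ t ω < d from ENNReal.coe_lt_coe.1 hc)
      obtain ⟨q, hq, hyq, hqd⟩ := hDd.exists_between hyd
      refine (iInf₂_le q hq).trans ?_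
      rw [hg]
      dsimp only
      rw [if_pos ⟨hy.1.trans hyq, hy.2.trans (h1 hyq)⟩]
      exact_mod_cast hqd.le
  · refine le_iInf₂ fun q _ => ?_
    rw [hg]
    dsimp only
    split_ifs with h
    · exact_mod_cast inverseSubordinator_le h.1 h.2
    · exact le_top

end

section

/-! ### Independent time changes of continuous processes -/

/-- The largest multiple of `1 / (k + 1)` below `y`. -/
def gridFloor (k : ℕ) (y : ℝ≥0) : ℝ≥0 := ⌊y * (k + 1)⌋₊ / (k + 1)

theorem tendsto_gridFloor (y : ℝ≥0) : Tendsto (fun k => gridFloor k y) atTop (𝓝 y) := by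
  rw [tendsto_iff_dist_tendsto_zero]
  refine squeeze_zero (fun _ => dist_nonneg) (fun k => ?_)
    tendsto_one_div_add_atTop_nhds_zero_nat
  have hk : (0 : ℝ) < k + 1 := by positivity
  have h1 : ((⌊y * (k + 1)⌋₊ : ℝ≥0) : ℝ) ≤ y * (k + 1) := by
    exact_mod_cast Nat.floor_le (bot_le : 0 ≤ y * (k + 1))
  have h2 : (y : ℝ) * (k + 1) < (⌊y * (k + 1)⌋₊ : ℝ) + 1 := by
    exact_mod_cast Nat.lt_floor_add_one (y * (k + 1))
  rw [NNReal.coe_natCast] at h1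
  rw [NNReal.dist_eq, gridFloor, abs_sub_comm]
  push_cast
  rw [abs_of_nonneg (sub_nonneg.2 ((div_le_iff₀ hk).2 h1)), sub_le_iff_le_add, ← add_div,
    le_div_iff₀ hk]
  linarith

theorem measurable_gridFloor (k : ℕ) : Measurable (gridFloor k) := by
  have h : Measurable fun y : ℝ≥0 => ⌊y * (k + 1)⌋₊ := Nat.measurable_floor.comp (by fun_prop)
  have h2 : Measurable fun j : ℕ => (j : ℝ≥0) / (k + 1) := measurable_from_top
  exact h2.comp h

variable {Ω : Type*} [MeasurableSpace Ω] {P : Measure Ω} {X : ℝ≥0 → Ω → ℝ} {T : Ω → ℝ≥0}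

theorem aemeasurable_comp_gridFloor (hX : ∀ t, AEMeasurable (X t) P) (hT : AEMeasurable T P)
    (k : ℕ) : AEMeasurable (fun ω => X (gridFloor k (T ω)) ω) P := by
  have hN : AEMeasurable (fun ω => ⌊T ω * (k + 1)⌋₊) P :=
    Nat.measurable_floor.comp_aemeasurable (by fun_prop)
  have h : Measurable fun p : (ℕ → ℝ) × ℕ => p.1 p.2 := by
    refine measurable_from_prod_countable_left fun j => ?_
    exact measurable_pi_apply j
  have hY : AEMeasurable (fun ω (j : ℕ) => X (j / (k + 1)) ω) P :=
    aemeasurable_pi_iff.2 fun j => hX _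
  exact h.comp_aemeasurable (hY.prodMk hN)

theorem aemeasurable_timeChange (hX : ∀ t, AEMeasurable (X t) P)
    (hc : ∀ᵐ ω ∂P, Continuous fun t => X t ω) (hT : AEMeasurable T P) :
    AEMeasurable (fun ω => X (T ω) ω) P := by
  refine aemeasurable_of_tendsto_metrizable_ae atTop
    (fun k => aemeasurable_comp_gridFloor hX hT k) ?_
  filter_upwards [hc] with ω hω
  exact (hω.tendsto _).comp (tendsto_gridFloor (T ω))

/-- The discretised clock takes countably many values; on each one the time is frozen, and
independence factors the expectation. -/
theorem lintegral_comp_gridFloor (hX : ∀ t, AEMeasurable (X t) P) (hT : AEMeasurable T P)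
    (hind : IndepFun (fun ω t => X t ω) T P) {φ : ℝ → ℝ≥0∞} (hφ : Measurable φ) (k : ℕ) :
    ∫⁻ ω, φ (X (gridFloor k (T ω)) ω) ∂P =
      ∫⁻ ω, ∫⁻ ω', φ (X (gridFloor k (T ω)) ω') ∂P ∂P := by
  have hψ : ∀ j : ℕ, Measurable fun y : ℝ≥0 => if ⌊y * (k + 1)⌋₊ = j then (1 : ℝ≥0∞) else 0 := by
    intro j
    have h : Measurable fun i : ℕ => if i = j then (1 : ℝ≥0∞) else 0 := measurable_from_top
    exact h.comp (Nat.measurable_floor.comp (by fun_prop))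
  have hψT : ∀ j : ℕ, AEMeasurable
      (fun ω => if ⌊T ω * (k + 1)⌋₊ = j then (1 : ℝ≥0∞) else 0) P := fun j =>
    (hψ j).comp_aemeasurable hT
  have hsum : ∀ (G : ℝ≥0 → ℝ≥0∞) (y : ℝ≥0), G (gridFloor k y) =
      ∑' j : ℕ, G (j / (k + 1)) * if ⌊y * (k + 1)⌋₊ = j then (1 : ℝ≥0∞) else 0 := by
    intro G y
    rw [tsum_eq_single ⌊y * (k + 1)⌋₊]
    · simp [gridFloor]
    · intro j hj
      rw [if_neg hj.symm, mul_zero]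
  calc ∫⁻ ω, φ (X (gridFloor k (T ω)) ω) ∂P
      = ∫⁻ ω, ∑' j : ℕ, φ (X (j / (k + 1)) ω) *
          (if ⌊T ω * (k + 1)⌋₊ = j then (1 : ℝ≥0∞) else 0) ∂P :=
        lintegral_congr fun ω => hsum (fun y => φ (X y ω)) (T ω)
    _ = ∑' j : ℕ, ∫⁻ ω, φ (X (j / (k + 1)) ω) *
          (if ⌊T ω * (k + 1)⌋₊ = j then (1 : ℝ≥0∞) else 0) ∂P :=
        lintegral_tsum fun j =>
          (hφ.comp_aemeasurable (hX _)).mul (hψT j)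
    _ = ∑' j : ℕ, ∫⁻ ω, (∫⁻ ω', φ (X (j / (k + 1)) ω') ∂P) *
          (if ⌊T ω * (k + 1)⌋₊ = j then (1 : ℝ≥0∞) else 0) ∂P := by
        refine tsum_congr fun j => ?_
        rw [lintegral_const_mul'' _ (hψT j)]
        exact lintegral_mul_eq_lintegral_mul_lintegral_of_indepFun''
          (hφ.comp_aemeasurable (hX _)) (hψT j)
          (hind.comp (hφ.comp (measurable_pi_apply _)) (hψ j))
    _ = ∫⁻ ω, ∑' j : ℕ, (∫⁻ ω', φ (X (j / (k + 1)) ω') ∂P) *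
          (if ⌊T ω * (k + 1)⌋₊ = j then (1 : ℝ≥0∞) else 0) ∂P :=
        (lintegral_tsum fun j => (hψT j).const_mul _).symm
    _ = _ := lintegral_congr fun ω => (hsum (fun y => ∫⁻ ω', φ (X y ω') ∂P) (T ω)).symm

theorem continuous_lintegral_comp [IsProbabilityMeasure P] (hX : ∀ t, AEMeasurable (X t) P)
    (hc : ∀ᵐ ω ∂P, Continuous fun t => X t ω) {φ : ℝ → ℝ≥0∞} (hφ : Continuous φ) {c : ℝ≥0∞}
    (hc' : c ≠ ∞) (hb : ∀ x, φ x ≤ c) : Continuous fun t => ∫⁻ ω, φ (X t ω) ∂P := by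
  refine continuous_iff_continuousAt.2 fun t => ?_
  refine tendsto_lintegral_filter_of_dominated_convergence' (fun _ => c)
    (Eventually.of_forall fun s => hφ.measurable.comp_aemeasurable (hX s))
    (Eventually.of_forall fun s => ae_of_all _ fun ω => hb _) (by simpa using hc') ?_
  filter_upwards [hc] with ω hω
  exact (hφ.comp hω).tendsto t

theorem lintegral_timeChange_of_bounded [IsProbabilityMeasure P] (hX : ∀ t, AEMeasurable (X t) P)
    (hc : ∀ᵐ ω ∂P, Continuous fun t => X t ω) (hT : AEMeasurable T P)
    (hind : IndepFun (fun ω t => X t ω) T P) {φ : ℝ → ℝ≥0∞} (hφ : Continuous φ) {c : ℝ≥0∞}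
    (hc' : c ≠ ∞) (hb : ∀ x, φ x ≤ c) :
    ∫⁻ ω, φ (X (T ω) ω) ∂P = ∫⁻ ω, ∫⁻ ω', φ (X (T ω) ω') ∂P ∂P := by
  have hW := continuous_lintegral_comp hX hc hφ hc' hb
  have h1 : Tendsto (fun k => ∫⁻ ω, φ (X (gridFloor k (T ω)) ω) ∂P) atTop
      (𝓝 (∫⁻ ω, φ (X (T ω) ω) ∂P)) := by
    refine tendsto_lintegral_of_dominated_convergence' (fun _ => c)
      (fun k => hφ.measurable.comp_aemeasurable (aemeasurable_comp_gridFloor hX hT k))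
      (fun k => ae_of_all _ fun ω => hb _) (by simpa using hc') ?_
    filter_upwards [hc] with ω hω
    exact ((hφ.comp hω).tendsto _).comp (tendsto_gridFloor (T ω))
  have h2 : Tendsto (fun k => ∫⁻ ω, ∫⁻ ω', φ (X (gridFloor k (T ω)) ω') ∂P ∂P) atTop
      (𝓝 (∫⁻ ω, ∫⁻ ω', φ (X (T ω) ω') ∂P ∂P)) := by
    refine tendsto_lintegral_of_dominated_convergence' (fun _ => c) (fun k => ?_)
      (fun k => ae_of_all _ fun ω => ?_) (by simpa using hc') (ae_of_all _ fun ω => ?_)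
    · exact (hW.measurable.comp (measurable_gridFloor k)).comp_aemeasurable hT
    · refine (lintegral_mono fun ω' => hb _).trans ?_
      simp
    · exact (hW.tendsto _).comp (tendsto_gridFloor (T ω))
  refine tendsto_nhds_unique (h1.congr fun k => ?_) h2
  exact lintegral_comp_gridFloor hX hT hind hφ.measurable k

theorem tendsto_min_natCast (a : ℝ≥0∞) : Tendsto (fun M : ℕ => min a M) atTop (𝓝 a) := by
  have h := (tendsto_const_nhds (x := a)).min ENNReal.tendsto_nat_nhds_top
  rwa [min_top_right] at h

/-- Conditioning on an independent time change of a continuous process. -/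
theorem lintegral_timeChange [IsProbabilityMeasure P] (hX : ∀ t, AEMeasurable (X t) P)
    (hc : ∀ᵐ ω ∂P, Continuous fun t => X t ω) (hT : AEMeasurable T P)
    (hind : IndepFun (fun ω t => X t ω) T P) {φ : ℝ → ℝ≥0∞} (hφ : Continuous φ) :
    ∫⁻ ω, φ (X (T ω) ω) ∂P = ∫⁻ ω, ∫⁻ ω', φ (X (T ω) ω') ∂P ∂P := by
  -- Truncation reduces to the bounded case; monotone convergence is applied to both the inner and
  -- the outer integral.
  have hφM : ∀ M : ℕ, Continuous fun x => min (φ x) (M : ℝ≥0∞) := fun M =>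
    hφ.min continuous_const
  have hmono : ∀ x, Monotone fun M : ℕ => min (φ x) (M : ℝ≥0∞) := fun x M N h =>
    min_le_min_left _ (by exact_mod_cast h)
  have hXT := aemeasurable_timeChange hX hc hT
  have h1 : Tendsto (fun M : ℕ => ∫⁻ ω, min (φ (X (T ω) ω)) (M : ℝ≥0∞) ∂P) atTop
      (𝓝 (∫⁻ ω, φ (X (T ω) ω) ∂P)) :=
    lintegral_tendsto_of_tendsto_of_monotone
      (fun M => (hφM M).measurable.comp_aemeasurable hXT) (ae_of_all _ fun ω => hmono _)
      (ae_of_all _ fun ω => tendsto_min_natCast _)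
  have hin : ∀ y, Tendsto (fun M : ℕ => ∫⁻ ω', min (φ (X y ω')) (M : ℝ≥0∞) ∂P) atTop
      (𝓝 (∫⁻ ω', φ (X y ω') ∂P)) := fun y =>
    lintegral_tendsto_of_tendsto_of_monotone
      (fun M => (hφM M).measurable.comp_aemeasurable (hX y)) (ae_of_all _ fun ω => hmono _)
      (ae_of_all _ fun ω => tendsto_min_natCast _)
  have h2 : Tendsto (fun M : ℕ => ∫⁻ ω, ∫⁻ ω', min (φ (X (T ω) ω')) (M : ℝ≥0∞) ∂P ∂P) atTop
      (𝓝 (∫⁻ ω, ∫⁻ ω', φ (X (T ω) ω') ∂P ∂P)) :=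
    lintegral_tendsto_of_tendsto_of_monotone
      (fun M => (continuous_lintegral_comp hX hc (hφM M) (ENNReal.natCast_ne_top M)
        fun x => min_le_right _ _).measurable.comp_aemeasurable hT)
      (ae_of_all _ fun ω M N h => lintegral_mono fun ω' => hmono _ h)
      (ae_of_all _ fun ω => hin _)
  refine tendsto_nhds_unique (h1.congr fun M => ?_) h2
  exact lintegral_timeChange_of_bounded hX hc hT hind (hφM M) (ENNReal.natCast_ne_top M)
    fun x => min_le_right _ _

/-! ### Moments of the time-changed process -/

section Moments

variable {H θ : ℝ} {B : ℝ≥0 → Ω → ℝ}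

theorem aemeasurable_fOU_timeChange (hB : IsFractionalBrownianMotion P H B)
    (hT : AEMeasurable T P) : AEMeasurable (fun ω => fOU θ B (T ω) ω) P :=
  aemeasurable_timeChange (aemeasurable_fOU hB)
    (hB.continuous_paths.mono fun _ hω => continuous_fOU hω) hT

theorem absMoment_nonneg (Y : ℝ≥0 → Ω → ℝ) (n : ℕ) (t : ℝ≥0) : 0 ≤ absMoment P Y n t :=
  integral_nonneg fun ω => by positivity

variable [IsProbabilityMeasure P]

theorem lintegral_pow_fOU_timeChange (hH : 1 / 2 < H) (hθ : 0 < θ)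
    (hB : IsFractionalBrownianMotion P H B) (hT : AEMeasurable T P)
    (hind : IndepFun (fun ω t => fOU θ B t ω) T P) (n : ℕ) :
    ∫⁻ ω, ENNReal.ofReal (|fOU θ B (T ω) ω| ^ n) ∂P =
      ∫⁻ ω, ENNReal.ofReal (absMoment P (fOU θ B) n (T ω)) ∂P := by
  have h := lintegral_timeChange (φ := fun x => ENNReal.ofReal (|x| ^ n))
    (aemeasurable_fOU (θ := θ) hB) (hB.continuous_paths.mono fun ω hω => continuous_fOU hω)
    hT hind (ENNReal.continuous_ofReal.comp (by fun_prop))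
  rw [h]
  refine lintegral_congr fun ω => ?_
  rw [absMoment, ofReal_integral_eq_lintegral_ofReal (integrable_fOU_pow hH hθ hB _ n)
    (ae_of_all _ fun ω => by positivity)]

theorem integrable_absMoment_comp (hH : 1 / 2 < H) (hθ : 0 < θ)
    (hB : IsFractionalBrownianMotion P H B) (hT : AEMeasurable T P) (n : ℕ) :
    Integrable (fun ω => absMoment P (fOU θ B) (2 * n) (T ω)) P := by
  refine Integrable.of_bound ((continuous_absMoment_fOU hH hθ hB
    n).measurable.comp_aemeasurable hT).aestronglyMeasurable (momentAtInfinity H θ n)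
    (ae_of_all _ fun ω => ?_)
  rw [Real.norm_eq_abs, abs_of_nonneg (absMoment_nonneg _ _ _)]
  exact absMoment_fOU_le hH hθ hB n _

theorem integrable_fOU_timeChange_pow (hH : 1 / 2 < H) (hθ : 0 < θ)
    (hB : IsFractionalBrownianMotion P H B) (hT : AEMeasurable T P)
    (hind : IndepFun (fun ω t => fOU θ B t ω) T P) (n : ℕ) :
    Integrable (fun ω => |fOU θ B (T ω) ω| ^ (2 * n)) P := by
  have hU := aemeasurable_fOU_timeChange (θ := θ) hB hT
  refine (lintegral_ofReal_ne_top_iff_integrable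
    (AEMeasurable.aestronglyMeasurable (by fun_prop))
    (ae_of_all _ fun ω => by positivity)).1 ?_
  rw [lintegral_pow_fOU_timeChange hH hθ hB hT hind]
  exact (lintegral_ofReal_ne_top_iff_integrable
    (integrable_absMoment_comp hH hθ hB hT n).aestronglyMeasurable
    (ae_of_all _ fun ω => absMoment_nonneg _ _ _)).2 (integrable_absMoment_comp hH hθ hB hT n)

theorem integral_fOU_timeChange_pow (hH : 1 / 2 < H) (hθ : 0 < θ)
    (hB : IsFractionalBrownianMotion P H B) (hT : AEMeasurable T P)
    (hind : IndepFun (fun ω t => fOU θ B t ω) T P) (n : ℕ) :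
    ∫ ω, |fOU θ B (T ω) ω| ^ (2 * n) ∂P = ∫ ω, absMoment P (fOU θ B) (2 * n) (T ω) ∂P := by
  rw [integral_eq_lintegral_of_nonneg_ae (ae_of_all _ fun ω => by positivity)
    (integrable_fOU_timeChange_pow hH hθ hB hT hind n).aestronglyMeasurable,
    integral_eq_lintegral_of_nonneg_ae (ae_of_all _ fun ω => absMoment_nonneg _ _ _)
    (integrable_absMoment_comp hH hθ hB hT n).aestronglyMeasurable,
    lintegral_pow_fOU_timeChange hH hθ hB hT hind]

theorem integral_fOU_timeChange_pow_le (hH : 1 / 2 < H) (hθ : 0 < θ)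
    (hB : IsFractionalBrownianMotion P H B) (hT : AEMeasurable T P)
    (hind : IndepFun (fun ω t => fOU θ B t ω) T P) (n : ℕ) :
    ∫ ω, |fOU θ B (T ω) ω| ^ (2 * n) ∂P ≤ momentAtInfinity H θ n := by
  rw [integral_fOU_timeChange_pow hH hθ hB hT hind]
  refine (integral_mono (integrable_absMoment_comp hH hθ hB hT n) (integrable_const _)
    fun ω => absMoment_fOU_le hH hθ hB n _).trans ?_
  simp

theorem abs_pow_le_one_add (x : ℝ) (m : ℕ) : |x| ^ m ≤ 1 + |x| ^ (2 * m) := by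
  rw [mul_comm 2 m, pow_mul]
  nlinarith [sq_nonneg (|x| ^ m - 1), pow_nonneg (abs_nonneg x) m]

/-- The moment of order $2m$ controls the one of order $m$ through $a\le 1+a^2$. The bound does not
involve `T`, hence is uniform in $t$ once `T` is $E(t)$. -/
theorem integrable_fOU_timeChange_abs_pow (hH : 1 / 2 < H) (hθ : 0 < θ)
    (hB : IsFractionalBrownianMotion P H B) (hT : AEMeasurable T P)
    (hind : IndepFun (fun ω t => fOU θ B t ω) T P) (m : ℕ) :
    Integrable (fun ω => |fOU θ B (T ω) ω| ^ m) P ∧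
      ∫ ω, |fOU θ B (T ω) ω| ^ m ∂P ≤ 1 + momentAtInfinity H θ m := by
  have hi := integrable_fOU_timeChange_pow hH hθ hB hT hind m
  have hi' : Integrable (fun ω => 1 + |fOU θ B (T ω) ω| ^ (2 * m)) P := (integrable_const _).add hi
  have hU := aemeasurable_fOU_timeChange (θ := θ) hB hT
  have hint : Integrable (fun ω => |fOU θ B (T ω) ω| ^ m) P := by
    refine hi'.mono' (AEMeasurable.aestronglyMeasurable (by fun_prop)) (ae_of_all _ fun ω => ?_)
    rw [Real.norm_eq_abs, abs_of_nonneg (by positivity)]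
    exact abs_pow_le_one_add _ m
  refine ⟨hint, (integral_mono hint hi' fun ω => abs_pow_le_one_add _ m).trans ?_⟩
  rw [integral_add (integrable_const _) hi]
  simpa using integral_fOU_timeChange_pow_le hH hθ hB hT hind m

variable {ν : Measure ℝ} {σ : ℝ≥0 → Ω → ℝ}

theorem absMoment_timeChange (hH : 1 / 2 < H) (hθ : 0 < θ)
    (hB : IsFractionalBrownianMotion P H B) (hν : ν (Ioi 0) = ∞)
    (hσ : IsDriftlessSubordinator P ν σ)
    (hind : IndepFun (fun ω t => fOU θ B t ω) (fun ω t => inverseSubordinator σ t ω) P)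
    (n : ℕ) (t : ℝ≥0) :
    absMoment P (timeChange (fOU θ B) (inverseSubordinator σ)) (2 * n) t =
      ∫ ω, absMoment P (fOU θ B) (2 * n) (inverseSubordinator σ t ω) ∂P :=
  integral_fOU_timeChange_pow hH hθ hB (hσ.aemeasurable_inverse hν t)
    (hind.comp measurable_id (measurable_pi_apply t)) n

/-- Since `ν` is infinite, `σ` is strictly increasing, so its inverse has continuous paths and the
moments of the time-changed process are continuous whether or not `E(t)` has a density. -/
theorem continuous_absMoment_timeChange (hH : 1 / 2 < H) (hθ : 0 < θ)
    (hB : IsFractionalBrownianMotion P H B) (hν : ν (Ioi 0) = ∞)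
    (hσ : IsDriftlessSubordinator P ν σ)
    (hind : IndepFun (fun ω t => fOU θ B t ω) (fun ω t => inverseSubordinator σ t ω) P)
    (n : ℕ) :
    Continuous (absMoment P (timeChange (fOU θ B) (inverseSubordinator σ)) (2 * n)) := by
  simp_rw [funext (absMoment_timeChange hH hθ hB hν hσ hind n)]
  have hV := continuous_absMoment_fOU hH hθ hB n
  refine continuous_of_dominated (bound := fun _ => momentAtInfinity H θ n)
    (fun t => (integrable_absMoment_comp hH hθ hB
      (hσ.aemeasurable_inverse hν t) n).aestronglyMeasurable)
    (fun t => ae_of_all _ fun ω => ?_) (integrable_const _) ?_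
  · rw [Real.norm_eq_abs, abs_of_nonneg (absMoment_nonneg _ _ _)]
    exact absMoment_fOU_le hH hθ hB n _
  · filter_upwards [hσ.ae_strictMono hν, hσ.ae_unbounded hν] with ω h1 h2
    exact hV.comp (continuous_inverseSubordinator h1 h2)

theorem monotone_absMoment_timeChange (hH : 1 / 2 < H) (hθ : 0 < θ)
    (hB : IsFractionalBrownianMotion P H B) (hν : ν (Ioi 0) = ∞)
    (hσ : IsDriftlessSubordinator P ν σ)
    (hind : IndepFun (fun ω t => fOU θ B t ω) (fun ω t => inverseSubordinator σ t ω) P)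
    (n : ℕ) :
    Monotone (absMoment P (timeChange (fOU θ B) (inverseSubordinator σ)) (2 * n)) := by
  intro s t hst
  rw [absMoment_timeChange hH hθ hB hν hσ hind, absMoment_timeChange hH hθ hB hν hσ hind]
  refine integral_mono_ae (integrable_absMoment_comp hH hθ hB (hσ.aemeasurable_inverse hν s) n)
    (integrable_absMoment_comp hH hθ hB (hσ.aemeasurable_inverse hν t) n) ?_
  filter_upwards [hσ.ae_strictMono hν, hσ.ae_unbounded hν] with ω h1 h2
  exact monotone_absMoment_fOU hH hθ hB n (monotone_inverseSubordinator h1 h2 hst)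

theorem tendsto_absMoment_timeChange (hH : 1 / 2 < H) (hθ : 0 < θ)
    (hB : IsFractionalBrownianMotion P H B) (hν : ν (Ioi 0) = ∞)
    (hσ : IsDriftlessSubordinator P ν σ)
    (hind : IndepFun (fun ω t => fOU θ B t ω) (fun ω t => inverseSubordinator σ t ω) P)
    (n : ℕ) :
    Tendsto (absMoment P (timeChange (fOU θ B) (inverseSubordinator σ)) (2 * n)) atTop
      (𝓝 (momentAtInfinity H θ n)) := by
  simp_rw [funext (absMoment_timeChange hH hθ hB hν hσ hind n)]
  have hconst : ∫ _, momentAtInfinity H θ n ∂P = momentAtInfinity H θ n := by simp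
  rw [← hconst]
  refine tendsto_integral_filter_of_dominated_convergence (fun _ => momentAtInfinity H θ n)
    (Eventually.of_forall fun t => (integrable_absMoment_comp hH hθ hB
      (hσ.aemeasurable_inverse hν t) n).aestronglyMeasurable)
    (Eventually.of_forall fun t => ae_of_all _ fun ω => ?_) (integrable_const _) ?_
  · rw [Real.norm_eq_abs, abs_of_nonneg (absMoment_nonneg _ _ _)]
    exact absMoment_fOU_le hH hθ hB n _
  · filter_upwards [hσ.ae_strictMono hν, hσ.ae_unbounded hν] with ω h1 h2
    exact (tendsto_absMoment_fOU hH hθ hB n).comp (tendsto_inverseSubordinator h1 h2)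

/-- The expectation of a bounded continuous function of the clock is its integral against the law of
`T`. Nonnegativity of `f` is needed only on $(0,\infty)$, where that law is carried. -/
theorem integral_density (hH : 1 / 2 < H) (hθ : 0 < θ)
    (hB : IsFractionalBrownianMotion P H B) (hT : AEMeasurable T P) (n : ℕ) {f : ℝ → ℝ}
    (hf : Measurable f) (hf0 : ∀ y, 0 < y → 0 ≤ f y)
    (hmap : P.map (fun ω => (T ω : ℝ)) =
      (volume.restrict (Ioi 0)).withDensity fun y => ENNReal.ofReal (f y)) :
    IntegrableOn (fun y => absMoment P (fOU θ B) (2 * n) y.toNNReal * f y) (Ioi 0) ∧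
      ∫ ω, absMoment P (fOU θ B) (2 * n) (T ω) ∂P =
        ∫ y in Ioi (0 : ℝ), absMoment P (fOU θ B) (2 * n) y.toNNReal * f y := by
  set V : ℝ → ℝ := fun y => absMoment P (fOU θ B) (2 * n) y.toNNReal with hV
  have hVc : Continuous V := (continuous_absMoment_fOU hH hθ hB n).comp continuous_real_toNNReal
  have hT' : AEMeasurable (fun ω => (T ω : ℝ)) P := by fun_prop
  have hVT : ∀ ω, V (T ω) = absMoment P (fOU θ B) (2 * n) (T ω) := fun ω => by simp [hV]
  have hint : Integrable V (P.map fun ω => (T ω : ℝ)) := by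
    rw [integrable_map_measure hVc.aestronglyMeasurable hT']
    exact (integrable_absMoment_comp hH hθ hB hT n).congr (ae_of_all _ fun ω => (hVT ω).symm)
  have hfm : Measurable fun y => ENNReal.ofReal (f y) := by fun_prop
  have htop : ∀ᵐ y ∂(volume.restrict (Ioi (0 : ℝ))), ENNReal.ofReal (f y) < ∞ :=
    ae_of_all _ fun y => ENNReal.ofReal_lt_top
  have hcongr : ∀ᵐ y ∂(volume.restrict (Ioi (0 : ℝ))),
      (ENNReal.ofReal (f y)).toReal • V y = V y * f y :=
    (ae_restrict_mem measurableSet_Ioi).mono fun y hy => by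
      rw [ENNReal.toReal_ofReal (hf0 y hy), smul_eq_mul, mul_comm]
  constructor
  · rw [hmap, integrable_withDensity_iff_integrable_smul' hfm htop] at hint
    exact hint.congr hcongr
  · simp_rw [← hVT]
    rw [← integral_map hT' hVc.aestronglyMeasurable, hmap,
      integral_withDensity_eq_integral_toReal_smul hfm htop]
    exact integral_congr_ae hcongr

end Moments

end

end TimeChangedFOU

end

theorem mainTheorem3 {Ω : Type*} [MeasurableSpace Ω] (P : Measure Ω) [IsProbabilityMeasure P]
    (H θ : ℝ) (hH : 1 / 2 < H) (hH1 : H < 1) (hθ : 0 < θ)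
    (B : ℝ≥0 → Ω → ℝ) (hB : TimeChangedFOU.IsFractionalBrownianMotion P H B)
    (ν : Measure ℝ) (hν : ν (Ioi 0) = ∞)
    (σ : ℝ≥0 → Ω → ℝ) (hσ : TimeChangedFOU.IsDriftlessSubordinator P ν σ)
    (U : ℝ≥0 → Ω → ℝ) (hU : U = TimeChangedFOU.fOU θ B)
    (E : ℝ≥0 → Ω → ℝ≥0) (hE : E = TimeChangedFOU.inverseSubordinator σ)
    (hindep : IndepFun (fun ω t => U t ω) (fun ω t => E t ω) P)
    (UΨ : ℝ≥0 → Ω → ℝ) (hUΨ : UΨ = TimeChangedFOU.timeChange U E)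
    (n : ℕ) :
    -- the moments exist, and `V_{2n}(∞)` is the limit of `V_{2n}(y)` as `y → ∞`
    ((∀ y, Integrable (fun ω => |U y ω| ^ (2 * n)) P) ∧
      Tendsto (TimeChangedFOU.absMoment P U (2 * n)) atTop
        (𝓝 (TimeChangedFOU.momentAtInfinity H θ n)) ∧
      ∀ t, Integrable (fun ω => |UΨ t ω| ^ (2 * n)) P) ∧
    -- 1) representation through the density
    (∀ f : ℝ≥0 → ℝ → ℝ, TimeChangedFOU.IsDensityFamily P E f → ∀ t : ℝ≥0, 0 < t →
      IntegrableOn (fun y => TimeChangedFOU.absMoment P U (2 * n) y.toNNReal * f t y) (Ioi 0) ∧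
      TimeChangedFOU.absMoment P UΨ (2 * n) t =
        ∫ y in Ioi (0 : ℝ), TimeChangedFOU.absMoment P U (2 * n) y.toNNReal * f t y) ∧
    -- 1) bound, for the even moments and then for all absolute moments
    (∀ t, TimeChangedFOU.absMoment P UΨ (2 * n) t ≤ TimeChangedFOU.momentAtInfinity H θ n) ∧
    (∀ m : ℕ, ∃ C : ℝ, ∀ t, Integrable (fun ω => |UΨ t ω| ^ m) P ∧
      TimeChangedFOU.absMoment P UΨ m t ≤ C) ∧
    -- 1) continuity
    (∀ f : ℝ≥0 → ℝ → ℝ, TimeChangedFOU.IsDensityFamily P E f →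
      (∀ y : ℝ, 0 < y → ContinuousOn (fun t => f t y) (Ioi 0)) →
      Continuous (TimeChangedFOU.absMoment P UΨ (2 * n))) ∧
    -- 2) monotonicity
    Monotone (TimeChangedFOU.absMoment P UΨ (2 * n)) ∧
    -- 3) limit, and its expression as a convergent multiple integral
    Tendsto (TimeChangedFOU.absMoment P UΨ (2 * n)) atTop
      (𝓝 (TimeChangedFOU.momentAtInfinity H θ n)) ∧
    IntegrableOn (TimeChangedFOU.multipleIntegrand H n) (TimeChangedFOU.orthant n) ∧
    TimeChangedFOU.momentAtInfinity H θ n =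
      2 ^ n * Real.Gamma ((2 * (n : ℝ) + 1) / 2) / √Real.pi *
        (H ^ n * (2 * H - 1) ^ n * Real.Gamma (2 * n * H + 1) * θ ^ (2 * n * H) *
          ∫ z in TimeChangedFOU.orthant n, TimeChangedFOU.multipleIntegrand H n z) := by
  subst hU hE hUΨ
  have hmeas : ∀ t, AEMeasurable (TimeChangedFOU.inverseSubordinator σ t) P := fun t =>
    hσ.aemeasurable_inverse hν t
  -- Conditioning uses the whole path of $U_H$ but only one coordinate of $E$ at a time.
  have hind : ∀ t, IndepFun (fun ω t => TimeChangedFOU.fOU θ B t ω)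
      (TimeChangedFOU.inverseSubordinator σ t) P := fun t =>
    hindep.comp measurable_id (measurable_pi_apply t)
  refine ⟨⟨fun y => TimeChangedFOU.integrable_fOU_pow hH hθ hB y _,
    TimeChangedFOU.tendsto_absMoment_fOU hH hθ hB n, fun t =>
      TimeChangedFOU.integrable_fOU_timeChange_pow hH hθ hB (hmeas t) (hind t) n⟩,
    fun f hf t ht => ?_, fun t =>
      TimeChangedFOU.integral_fOU_timeChange_pow_le hH hθ hB (hmeas t) (hind t) n,
    fun m => ⟨_, fun t =>
      TimeChangedFOU.integrable_fOU_timeChange_abs_pow hH hθ hB (hmeas t) (hind t) m⟩,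
    fun _ _ _ => TimeChangedFOU.continuous_absMoment_timeChange hH hθ hB hν hσ hindep n,
    TimeChangedFOU.monotone_absMoment_timeChange hH hθ hB hν hσ hindep n,
    TimeChangedFOU.tendsto_absMoment_timeChange hH hθ hB hν hσ hindep n,
    TimeChangedFOU.integrableOn_multipleIntegrand hH n,
    TimeChangedFOU.momentAtInfinity_eq_multipleIntegral hH hθ n⟩
  obtain ⟨hf1, hf2, hf3⟩ := hf t ht
  rw [TimeChangedFOU.absMoment_timeChange hH hθ hB hν hσ hindep]
  exact TimeChangedFOU.integral_density hH hθ hB (hmeas t) n hf1 hf2 hf3
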